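/- Let $V:\mathbb R\to\mathbb R$ be smooth and even, $V=V_{\rm per}+V_{\rm def}$, where $V_{\rm per}(x+1)=V_{\rm per}(x)$ for all $x$ and $V_{\rm def}(x)=0$ for $|x|>\rho$, for some $\rho\ge 0$. Let $E>0$ and let $\Phi\in L^2(\mathbb R)$, $\Phi\neq 0$, satisfy $-\Phi''+V\Phi=E\Phi$ (a bound state of $H=D_x^2+V$, $D_x=-i\,d/dx$). Then $\Phi$ is even or odd. For $z\in\mathbb C$ let $u_z$ be the solution of $-u_z''+Vu_z=zu_z$ with $u_z(0)=1,\ u_z'(0)=0$ if $\Phi$ is even, and $u_z(0)=0,\ u_z'(0)=1$ if $\Phi$ is odd. For $M>0$ put $$\Theta(z)=\Theta_M(z)=u_z'(M)-i\sqrt z\,u_z(M),$$ with the principal branch of the square root. The periodic equation $-y''+V_{\rm per}y=Ey$ has real Floquet multipliers $\mu,\mu^{-1}$ with $|\mu|>1$ (that is, nonzero solutions with $y(x+1)=\mu^{\pm1}y(x)$ for all $x$); let $\kappa=\log|\mu|>0$. For every $k$ with $0<k<\kappa$ (in particular for some $k>0$) there is $M_0>\rho$ such that for all real $M\ge M_0$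 one has $\partial_z\Theta(E)\ne0$ and: 1. $\Theta$ has a unique root $z^*$ in the ball $\Omega_M=\{z\in\mathbb C:\ |z-E|\le M^{-2}e^{-kM}\}$; 2. $z^*=E-\dfrac{\Theta(E)}{\partial_z\Theta(E)}+O(e^{-4kM})$, with an implied constant independent of $M$. For $k=\kappa$ the same holds with the error in (2) replaced by $O(M e^{-4\kappa M})$. -/

import Mathlib

open scoped ContDiff

/-- `u` is a classical solution on `ℝ` of the Schrödinger equation `(D_x² + V - z) u = 0`, where
`D_x = -i d/dx`, that is, of `-u'' + V u = z u`. -/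
def SolvesSchrodinger (V : ℝ → ℝ) (z : ℂ) (u : ℝ → ℂ) : Prop :=
  ContDiff ℝ 2 u ∧ ∀ x : ℝ, -(deriv (deriv u) x) + (V x : ℂ) * u x = z * u x

/-- `Φ` is a bound state of `H = D_x² + V` with energy `E`: a nonzero square-integrable solution
of `H Φ = E Φ`. -/
def IsBoundState (V : ℝ → ℝ) (E : ℝ) (Φ : ℝ → ℂ) : Prop :=
  SolvesSchrodinger V (E : ℂ) Φ ∧ MeasureTheory.MemLp Φ 2 MeasureTheory.volume ∧ Φ ≠ 0

/-- `μ` is a (real) Floquet multiplier at energy `E` of the Schrödinger equation with 1-periodic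
potential `W`: some nonzero solution is multiplied by `μ` under translation by one period. -/
def IsFloquetMultiplier (W : ℝ → ℝ) (E μ : ℝ) : Prop :=
  ∃ y : ℝ → ℂ, SolvesSchrodinger W (E : ℂ) y ∧ y ≠ 0 ∧ ∀ x : ℝ, y (x + 1) = (μ : ℂ) * y x

/-- `Θ(z) = u_z'(M) - i √z u_z(M)` for a family `z ↦ u_z`, with the principal square root. -/
noncomputable def outgoingTheta (u : ℂ → ℝ → ℂ) (M : ℝ) (z : ℂ) : ℂ :=
  deriv (u z) M - Complex.I * Complex.sqrt z * u z M

/-- `Θ` has exactly one zero `z*` in the closed ball of radius `r` about `E`, one has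
`∂_z Θ(E) ≠ 0` (in particular `Θ` is complex differentiable at `E`), and
`|z* - (E - Θ(E) / ∂_z Θ(E))| ≤ err`. -/
def HasUniqueRootNear (Θ : ℂ → ℂ) (E r err : ℝ) : Prop :=
  deriv Θ (E : ℂ) ≠ 0 ∧
  ∃ zs : ℂ, ‖zs - (E : ℂ)‖ ≤ r ∧ Θ zs = 0 ∧
    (∀ w : ℂ, ‖w - (E : ℂ)‖ ≤ r → Θ w = 0 → w = zs) ∧
    ‖zs - ((E : ℂ) - Θ (E : ℂ) / deriv Θ (E : ℂ))‖ ≤ err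

/-!
A square-integrable solution of the Schrödinger equation with bounded potential decays together with
its derivative, so the Wronskian of `Φ` with its reflection, a constant, vanishes; this forces the
parity of `Φ`. Past the defect `Φ` solves the periodic equation, and a decaying solution of that
equation is unique up to scaling, hence is a Floquet solution with a multiplier `c`, `|c| < 1`; its
reflection has multiplier `c⁻¹`. With `κ = -log |c|` the solution `u_E` is `O(e^{-κx})`, and every
other solution at energy `E` is `O(e^{κx})`.

Differentiating the equation in `z` gives `W(u_E, ∂_z u_E)(M) = -∫₀ᴹ u_E²`, which stays away from
`0`; since `u_E(M)` and `u_E'(M)` are `O(e^{-κM})`, `∂_zΘ(E)` is at least of order `e^{κM}`.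
Variation of constants shows that on the ball of radius `E / M` the function `Θ - Θ(E)` is
`O(e^{κM} |z - E|)`, and Cauchy's estimate bounds its second-order Taylor remainder by
`O(M e^{κM} |z - E|²)`. Against `|Θ(E)| = O(e^{-κM})` a contraction argument around `E` gives the
unique root, at distance `O(e^{-2κM})` from `E`, and the remainder at the root divided by `∂_zΘ(E)`
is the error `O(M e^{-4κM})` of one Newton step.
-/

open Filter MeasureTheory Topology

section LinearODE

variable {F : Type*} [NormedAddCommGroup F] [NormedSpace ℝ F] {A : ℝ → F →L[ℝ] F}

/-- The weight `cosh (2 ∫ ‖A‖)`, with respect to which the Volterra operator of `y' = A y` halves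
the supremum norm. The hyperbolic cosine, rather than `exp (2 |∫ ‖A‖|)`, makes the weight
differentiable at the base point `x₀`. -/
noncomputable def volterraWeight (A : ℝ → F →L[ℝ] F) (x₀ x : ℝ) : ℝ :=
  Real.cosh (2 * ∫ s in x₀..x, ‖A s‖)

theorem one_le_volterraWeight (A : ℝ → F →L[ℝ] F) (x₀ x : ℝ) : 1 ≤ volterraWeight A x₀ x :=
  Real.one_le_cosh _

theorem continuous_volterraWeight (hA : Continuous A) (x₀ : ℝ) :
    Continuous (volterraWeight A x₀) :=
  Real.continuous_cosh.comp <| continuous_const.mul <|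
    intervalIntegral.continuous_primitive (fun _ _ => hA.norm.intervalIntegrable _ _) x₀

theorem abs_integral_volterraWeight_mul_norm_le (hA : Continuous A) (x₀ x : ℝ) :
    |∫ t in x₀..x, volterraWeight A x₀ t * ‖A t‖| ≤ volterraWeight A x₀ x / 2 := by
  have hderiv (t : ℝ) : HasDerivAt (fun t => Real.sinh (2 * ∫ s in x₀..t, ‖A s‖) / 2)
      (volterraWeight A x₀ t * ‖A t‖) t :=
    (((hA.norm.integral_hasStrictDerivAt x₀ t).hasDerivAt.const_mul 2).sinh.div_const 2).congr_deriv
      (by rw [volterraWeight]; ring)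
  rw [intervalIntegral.integral_eq_sub_of_hasDerivAt (fun t _ => hderiv t)
    (((continuous_volterraWeight hA x₀).mul hA.norm).intervalIntegrable _ _)]
  simp only [intervalIntegral.integral_same, mul_zero, Real.sinh_zero, zero_div, sub_zero]
  rw [abs_div, abs_two, Real.abs_sinh, volterraWeight, ← Real.cosh_abs]
  gcongr
  exact (Real.sinh_lt_cosh _).le

theorem norm_integral_volterraWeight_smul_le (hA : Continuous A) {h : ℝ → F} {C : ℝ}
    (hC : ∀ t, ‖h t‖ ≤ C) (x₀ x : ℝ) :
    ‖(volterraWeight A x₀ x)⁻¹ • ∫ t in x₀..x, volterraWeight A x₀ t • A t (h t)‖ ≤ C / 2 := by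
  have hpos (t : ℝ) : 0 < volterraWeight A x₀ t :=
    zero_lt_one.trans_le (one_le_volterraWeight A x₀ t)
  have hC₀ : 0 ≤ C := (norm_nonneg _).trans (hC 0)
  rw [norm_smul, norm_inv, Real.norm_of_nonneg (hpos x).le, inv_mul_le_iff₀ (hpos x)]
  calc ‖∫ t in x₀..x, volterraWeight A x₀ t • A t (h t)‖
      ≤ |∫ t in x₀..x, C * (volterraWeight A x₀ t * ‖A t‖)| := by
        refine intervalIntegral.norm_integral_le_abs_of_norm_le (.of_forall fun t => ?_)
          ((continuous_const.mul
            ((continuous_volterraWeight hA x₀).mul hA.norm)).intervalIntegrable _ _)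
        rw [norm_smul, Real.norm_of_nonneg (hpos t).le, mul_left_comm, mul_comm C]
        exact mul_le_mul_of_nonneg_left ((A t).le_opNorm_of_le (hC t)) (hpos t).le
    _ = C * |∫ t in x₀..x, volterraWeight A x₀ t * ‖A t‖| := by
        rw [intervalIntegral.integral_const_mul, abs_mul, abs_of_nonneg hC₀]
    _ ≤ C * (volterraWeight A x₀ x / 2) := by
        gcongr
        exact abs_integral_volterraWeight_mul_norm_le hA x₀ x
    _ = volterraWeight A x₀ x * (C / 2) := by ring

open BoundedContinuousFunction in
theorem exists_forall_eq_add_integral [CompleteSpace F] (hA : Continuous A) (x₀ : ℝ) (y₀ : F) :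
    ∃ y : ℝ → F, Continuous y ∧ ∀ x, y x = y₀ + ∫ t in x₀..x, A t (y t) := by
  set w := volterraWeight A x₀
  have hwc : Continuous w := continuous_volterraWeight hA x₀
  have hw1 : ∀ x, 1 ≤ w x := one_le_volterraWeight A x₀
  have hw0 (x : ℝ) : w x ≠ 0 := (zero_lt_one.trans_le (hw1 x)).ne'
  have hint (h : ℝ →ᵇ F) (a b : ℝ) :
      IntervalIntegrable (fun t => w t • A t (h t)) volume a b :=
    (hwc.smul (hA.clm_apply h.continuous)).intervalIntegrable a b
  let T (h : ℝ →ᵇ F) : ℝ →ᵇ F := ofNormedAddCommGroup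
    (fun x => (w x)⁻¹ • y₀ + (w x)⁻¹ • ∫ t in x₀..x, w t • A t (h t))
    (((hwc.inv₀ hw0).smul continuous_const).add
      ((hwc.inv₀ hw0).smul (intervalIntegral.continuous_primitive (hint h) x₀)))
    (‖y₀‖ + ‖h‖ / 2) fun x => (norm_add_le _ _).trans <| by
      refine add_le_add ?_ (norm_integral_volterraWeight_smul_le hA h.norm_coe_le_norm x₀ x)
      rw [norm_smul, norm_inv, Real.norm_of_nonneg (zero_le_one.trans (hw1 x))]
      exact mul_le_of_le_one_left (norm_nonneg _) (inv_le_one_of_one_le₀ (hw1 x))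
  have hT : ContractingWith (1 / 2) T := by
    refine ⟨by norm_num, LipschitzWith.of_dist_le_mul fun g h => ?_⟩
    rw [dist_eq_norm, dist_eq_norm]
    refine (norm_le (by positivity)).2 fun x => ?_
    have hsub : (T g - T h) x = (w x)⁻¹ • ∫ t in x₀..x, w t • A t ((g - h) t) := by
      simp only [T, coe_sub, Pi.sub_apply, coe_ofNormedAddCommGroup, map_sub, smul_sub,
        add_sub_add_left_eq_sub]
      rw [← smul_sub, ← intervalIntegral.integral_sub (hint g _ _) (hint h _ _)]
    rw [hsub]
    refine (norm_integral_volterraWeight_smul_le hA (g - h).norm_coe_le_norm x₀ x).trans_eq ?_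
    simp [div_eq_inv_mul]
  obtain ⟨h, hfix⟩ : ∃ h, T h = h := ⟨_, hT.fixedPoint_isFixedPt⟩
  refine ⟨fun x => w x • h x, hwc.smul h.continuous, fun x => ?_⟩
  have hx : (w x)⁻¹ • y₀ + (w x)⁻¹ • ∫ t in x₀..x, w t • A t (h t) = h x :=
    DFunLike.congr_fun hfix x
  simp only [map_smul]
  rw [← hx, ← smul_add, smul_inv_smul₀ (hw0 x)]

theorem exists_forall_hasDerivAt_linear [CompleteSpace F] (hA : Continuous A) (x₀ : ℝ) (y₀ : F) :
    ∃ y : ℝ → F, y x₀ = y₀ ∧ ∀ x, HasDerivAt y (A x (y x)) x := by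
  obtain ⟨y, hy, hint⟩ := exists_forall_eq_add_integral hA x₀ y₀
  refine ⟨y, by simp [hint x₀], fun x => ?_⟩
  rw [funext hint]
  simpa only [← hint] using
    ((hA.clm_apply hy).integral_hasStrictDerivAt x₀ x).hasDerivAt.const_add y₀

end LinearODE

section Wronskian

/-- The Wronskian determinant of two vectors of Cauchy data `(u, u')`. -/
def wronskian {R : Type*} [CommRing R] (v w : R × R) : R := v.1 * w.2 - v.2 * w.1

theorem wronskian_smul_eq_sub {R : Type*} [CommRing R] (p r v : R × R) :
    wronskian p r • v = wronskian v r • p - wronskian v p • r := by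
  ext <;> simp only [wronskian, Prod.smul_fst, Prod.smul_snd, Prod.fst_sub, Prod.snd_sub,
    smul_eq_mul] <;> ring

variable {K : Type*} [Field K]

theorem exists_wronskian_eq_one {v : K × K} (hv : v ≠ 0) : ∃ w, wronskian v w = 1 := by
  by_cases h₁ : v.1 = 0
  · have h₂ : v.2 ≠ 0 := fun h₂ => hv (Prod.ext h₁ h₂)
    exact ⟨(-v.2⁻¹, 0), by simp [wronskian, h₂]⟩
  · exact ⟨(0, v.1⁻¹), by simp [wronskian, h₁]⟩

theorem exists_eq_smul_of_wronskian_eq_zero {v w : K × K} (hv : v ≠ 0) (h : wronskian v w = 0) :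
    ∃ c : K, w = c • v := by
  obtain ⟨r, hr⟩ := exists_wronskian_eq_one hv
  have hw : wronskian w v = 0 := by rw [← neg_eq_zero, ← h]; simp only [wronskian]; ring
  exact ⟨wronskian w r, by simpa [hr, hw] using wronskian_smul_eq_sub v r w⟩

theorem norm_wronskian_le {R : Type*} [NormedCommRing R] (v w : R × R) :
    ‖wronskian v w‖ ≤ 2 * (‖v‖ * ‖w‖) := by
  calc ‖wronskian v w‖ ≤ ‖v.1‖ * ‖w.2‖ + ‖v.2‖ * ‖w.1‖ :=
        (norm_sub_le _ _).trans (add_le_add (norm_mul_le _ _) (norm_mul_le _ _))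
    _ ≤ ‖v‖ * ‖w‖ + ‖v‖ * ‖w‖ := by
        gcongr <;> first | exact norm_fst_le _ | exact norm_snd_le _
    _ = 2 * (‖v‖ * ‖w‖) := by ring

theorem tendsto_wronskian_zero {R α : Type*} [CommRing R] [TopologicalSpace R]
    [IsTopologicalRing R] {l : Filter α} {f g : α → R × R} (hf : Tendsto f l (𝓝 0))
    (hg : Tendsto g l (𝓝 0)) : Tendsto (fun x => wronskian (f x) (g x)) l (𝓝 0) := by
  simpa [wronskian] using (hf.fst_nhds.mul hg.snd_nhds).sub (hf.snd_nhds.mul hg.fst_nhds)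

end Wronskian

/-- `y = (u, u')` is the Cauchy data of a solution of `u'' = q u` on the real line. -/
def IsSolution (q : ℝ → ℂ) (y : ℝ → ℂ × ℂ) : Prop :=
  ∀ x, HasDerivAt y ((y x).2, q x * (y x).1) x

/-- The Cauchy data of the reflected function `x ↦ u (-x)`, where `y = (u, u')`. -/
def reflection (y : ℝ → ℂ × ℂ) (x : ℝ) : ℂ × ℂ := ((y (-x)).1, -(y (-x)).2)

theorem IsSolution.exists_apply_eq {q : ℝ → ℂ} (hq : Continuous q) (x₀ : ℝ) (v : ℂ × ℂ) :
    ∃ y, IsSolution q y ∧ y x₀ = v := by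
  let A (x : ℝ) : ℂ × ℂ →L[ℝ] ℂ × ℂ :=
    (ContinuousLinearMap.inl ℝ ℂ ℂ).comp (ContinuousLinearMap.snd ℝ ℂ ℂ) +
      q x • (ContinuousLinearMap.inr ℝ ℂ ℂ).comp (ContinuousLinearMap.fst ℝ ℂ ℂ)
  obtain ⟨y, hy₀, hy⟩ :=
    exists_forall_hasDerivAt_linear (by fun_prop : Continuous A) x₀ v
  exact ⟨y, fun x => (hy x).congr_deriv (by simp [A]), hy₀⟩

namespace IsSolution

variable {q Q : ℝ → ℂ} {u y : ℝ → ℂ × ℂ}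

protected theorem continuous (hy : IsSolution q y) : Continuous y :=
  continuous_iff_continuousAt.2 fun x => (hy x).continuousAt

theorem hasDerivAt_fst (hy : IsSolution q y) (x : ℝ) :
    HasDerivAt (fun x => (y x).1) (y x).2 x :=
  (hasFDerivAt_fst (𝕜 := ℝ) (p := y x)).comp_hasDerivAt x (hy x)

theorem hasDerivAt_snd (hy : IsSolution q y) (x : ℝ) :
    HasDerivAt (fun x => (y x).2) (q x * (y x).1) x :=
  (hasFDerivAt_snd (𝕜 := ℝ) (p := y x)).comp_hasDerivAt x (hy x)

theorem const_smul (hy : IsSolution q y) (c : ℂ) : IsSolution q fun x => c • y x := fun x => by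
  refine ((hy x).const_smul c).congr_deriv ?_
  simp [mul_left_comm]

protected theorem star (hy : IsSolution q y) : IsSolution (star q) (star y) := fun x =>
  (hy x).star.congr_deriv (by ext <;> simp)

theorem comp_add_const (hy : IsSolution q y) {a : ℝ} (hq : q.Periodic a) :
    IsSolution q fun x => y (x + a) := fun x => by
  simpa only [hq x] using (hy (x + a)).comp_add_const x a

theorem reflect (hy : IsSolution q y) (hq : q.Even) : IsSolution q (reflection y) := fun x => by
  have h₁ := (hy.hasDerivAt_fst (-x)).scomp x (hasDerivAt_neg x)
  have h₂ := ((hy.hasDerivAt_snd (-x)).scomp x (hasDerivAt_neg x)).neg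
  refine (h₁.prodMk h₂).congr_deriv ?_
  simp [reflection, hq x]

theorem wronskian_sub_wronskian_eq_integral (hu : IsSolution q u) (hy : IsSolution Q y)
    (hq : Continuous q) (hQ : Continuous Q) (a b : ℝ) :
    wronskian (u b) (y b) - wronskian (u a) (y a) =
      ∫ t in a..b, (Q t - q t) * ((u t).1 * (y t).1) := by
  have hderiv (t : ℝ) : HasDerivAt (fun t => wronskian (u t) (y t))
      ((Q t - q t) * ((u t).1 * (y t).1)) t :=
    (((hu.hasDerivAt_fst t).mul (hy.hasDerivAt_snd t)).sub
      ((hu.hasDerivAt_snd t).mul (hy.hasDerivAt_fst t))).congr_deriv (by ring)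
  have := hu.continuous
  have := hy.continuous
  exact (intervalIntegral.integral_eq_sub_of_hasDerivAt (fun t _ => hderiv t)
    ((by fun_prop : Continuous _).intervalIntegrable a b)).symm

theorem wronskian_eq_wronskian (hu : IsSolution q u) (hy : IsSolution q y) (hq : Continuous q)
    (a b : ℝ) : wronskian (u a) (y a) = wronskian (u b) (y b) := by
  simpa [sub_eq_zero] using hu.wronskian_sub_wronskian_eq_integral hy hq hq b a

theorem wronskian_eq_zero_of_tendsto (hu : IsSolution q u) (hy : IsSolution q y)
    (hq : Continuous q) {l : Filter ℝ} [l.NeBot]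
    (h : l.Tendsto (fun x => wronskian (u x) (y x)) (𝓝 0)) (x : ℝ) :
    wronskian (u x) (y x) = 0 := by
  simp only [hu.wronskian_eq_wronskian hy hq _ x] at h
  exact tendsto_nhds_unique tendsto_const_nhds h

/-- Both `u` and `y` are tested against the solutions for `Q` with Cauchy data `(1, 0)` and `(0, 1)`
at `x`. -/
theorem apply_eq_of_eqOn_uIcc (hu : IsSolution q u) (hy : IsSolution Q y) (hq : Continuous q)
    (hQ : Continuous Q) {x₀ x : ℝ} (hqQ : Set.EqOn q Q (Set.uIcc x₀ x)) (h₀ : u x₀ = y x₀) :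
    u x = y x := by
  have htest {w : ℝ → ℂ × ℂ} (hw : IsSolution Q w) :
      wronskian (u x) (w x) = wronskian (y x) (w x) := by
    rw [hy.wronskian_eq_wronskian hw hQ x x₀, ← h₀, ← sub_eq_zero,
      hu.wronskian_sub_wronskian_eq_integral hw hq hQ]
    refine intervalIntegral.integral_zero_ae (.of_forall fun t ht => ?_)
    rw [hqQ (Set.uIoc_subset_uIcc ht), sub_self, zero_mul]
  obtain ⟨p, hp, hpx⟩ := exists_apply_eq hQ x (1, 0)
  obtain ⟨r, hr, hrx⟩ := exists_apply_eq hQ x (0, 1)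
  ext
  · simpa [wronskian, hrx] using htest hr
  · simpa [wronskian, hpx] using htest hp

theorem eq_of_apply_eq (hu : IsSolution q u) (hy : IsSolution q y) (hq : Continuous q) {x₀ : ℝ}
    (h₀ : u x₀ = y x₀) : u = y :=
  funext fun _ => hu.apply_eq_of_eqOn_uIcc hy hq hq (fun _ _ => rfl) h₀

end IsSolution

section Decay

theorem sq_intervalIntegral_unit_le {g : ℝ → ℝ} (hg : Continuous g) (x : ℝ) :
    (∫ t in x..x + 1, g t) ^ 2 ≤ ∫ t in x..x + 1, g t ^ 2 := by
  have hx : x ≤ x + 1 := by linarith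
  have : IsProbabilityMeasure (volume.restrict (Set.Ioc x (x + 1))) := ⟨by simp⟩
  simp only [intervalIntegral.integral_of_le hx]
  have hg' : ∀ {h : ℝ → ℝ}, Continuous h → Integrable h (volume.restrict (Set.Ioc x (x + 1))) :=
    fun hh => hh.integrableOn_Ioc
  exact even_two.convexOn_pow.map_integral_le (by fun_prop) isClosed_univ (by simp) (hg' hg)
    (hg' (hg.pow 2))

theorem tendsto_intervalIntegral_unit_atTop {g : ℝ → ℝ} (hg : Integrable g) :
    Tendsto (fun x => ∫ t in x..x + 1, g t) atTop (𝓝 0) := by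
  have hlim := intervalIntegral_tendsto_integral_Ioi 0 hg.integrableOn tendsto_id
  have hlim₁ := hlim.comp (tendsto_atTop_add_const_right _ 1 tendsto_id)
  refine (sub_self (∫ t in Set.Ioi 0, g t) ▸ hlim₁.sub hlim).congr fun x => ?_
  exact intervalIntegral.integral_interval_sub_left hg.intervalIntegrable hg.intervalIntegrable

theorem tendsto_intervalIntegral_unit_norm_of_memLp_two {f : ℝ → ℂ} (hc : Continuous f)
    (hf : MemLp f 2) : Tendsto (fun x => ∫ t in x..x + 1, ‖f t‖) atTop (𝓝 0) := by
  have hsq := tendsto_intervalIntegral_unit_atTop ((memLp_two_iff_integrable_sq_norm hf.1).1 hf)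
  refine squeeze_zero (fun x => ?_) (fun x => ?_) (Real.sqrt_zero ▸ hsq.sqrt)
  · exact intervalIntegral.integral_nonneg (by linarith) fun t _ => norm_nonneg _
  · exact Real.le_sqrt_of_sq_le (sq_intervalIntegral_unit_le hc.norm x)

theorem integral_affine_mul_affine (a b α β : ℂ) :
    ∫ s in (0 : ℝ)..1, (α + β * s) * (a + s * b) = α * a + (α * b + β * a) / 2 + β * b / 3 := by
  have hderiv (s : ℝ) : HasDerivAt
      (fun s : ℝ => α * a * s + (α * b + β * a) / 2 * (s : ℂ) ^ 2 + β * b / 3 * (s : ℂ) ^ 3)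
      ((α + β * s) * (a + s * b)) s := by
    have hs := (hasDerivAt_id' s).ofReal_comp
    exact (((hs.const_mul _).add ((hs.pow 2).const_mul _)).add ((hs.pow 3).const_mul _)).congr_deriv
      (by push_cast; ring)
  rw [intervalIntegral.integral_eq_sub_of_hasDerivAt (fun s _ => hderiv s)
    ((by fun_prop : Continuous _).intervalIntegrable _ _)]
  simp

/-- The kernels `4 - 6 s` and `12 s - 6` recover the coefficients of an affine function from its
values on `[0, 1]`. -/
theorem norm_le_six_mul_integral_norm_add_mul (v : ℂ × ℂ) :
    ‖v‖ ≤ 6 * ∫ s in (0 : ℝ)..1, ‖v.1 + s * v.2‖ := by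
  have hkernel (α β : ℝ) (hαβ : ∀ s ∈ Set.Ioc (0 : ℝ) 1, |α + β * s| ≤ 6) :
      ‖α * v.1 + (α * v.2 + β * v.1) / 2 + β * v.2 / 3‖ ≤
        6 * ∫ s in (0 : ℝ)..1, ‖v.1 + s * v.2‖ := by
    rw [← integral_affine_mul_affine, ← intervalIntegral.integral_const_mul]
    refine intervalIntegral.norm_integral_le_of_norm_le zero_le_one (.of_forall fun s hs => ?_)
      ((by fun_prop : Continuous _).intervalIntegrable _ _)
    rw [norm_mul]
    gcongr
    exact_mod_cast hαβ s hs
  refine norm_prod_le_iff.2 ⟨(congrArg norm ?_).trans_le (hkernel 4 (-6) fun s hs => ?_),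
    (congrArg norm ?_).trans_le (hkernel (-6) 12 fun s hs => ?_)⟩
  · push_cast; ring
  · exact abs_le.2 ⟨by linarith [hs.2], by linarith [hs.1]⟩
  · push_cast; ring
  · exact abs_le.2 ⟨by linarith [hs.1], by linarith [hs.2]⟩

namespace IsSolution

variable {q : ℝ → ℂ} {y : ℝ → ℂ × ℂ}

theorem norm_fst_add_mul_snd_le (hy : IsSolution q y) (hq : Continuous q) {x Q : ℝ}
    (hQ : ∀ t ≥ x, ‖q t‖ ≤ Q) {s : ℝ} (hs : s ∈ Set.Icc (0 : ℝ) 1) :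
    ‖(y x).1 + s * (y x).2‖ ≤ ‖(y (x + s)).1‖ + Q * ∫ t in x..x + 1, ‖(y t).1‖ := by
  have haffine : IsSolution 0 fun t => ((t - (x + s) : ℂ), 1) := fun t => by
    simpa using ((hasDerivAt_id' t).ofReal_comp.sub_const (x + s : ℂ)).prodMk (hasDerivAt_const t 1)
  have hgreen := hy.wronskian_sub_wronskian_eq_integral haffine hq continuous_const x (x + s)
  have htaylor : (y x).1 + s * (y x).2 =
      (y (x + s)).1 + ∫ t in x..x + s, q t * ((y t).1 * (t - (x + s))) := by
    simp only [wronskian, Pi.zero_apply, zero_sub, neg_mul, intervalIntegral.integral_neg] at hgreen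
    push_cast at hgreen
    linear_combination -hgreen
  have hcont : Continuous fun t => ‖(y t).1‖ := hy.continuous.fst.norm
  rw [htaylor]
  refine (norm_add_le _ _).trans (add_le_add_right ?_ _)
  rw [← intervalIntegral.integral_const_mul]
  have hQ₀ : 0 ≤ Q := (norm_nonneg _).trans (hQ x le_rfl)
  calc ‖∫ t in x..x + s, q t * ((y t).1 * (t - (x + s)))‖
      ≤ ∫ t in x..x + s, Q * ‖(y t).1‖ := by
        refine intervalIntegral.norm_integral_le_of_norm_le (by linarith [hs.1])
          (.of_forall fun t ht => ?_) ((hcont.const_mul Q).intervalIntegrable _ _)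
        have hts : ‖(t - (x + s) : ℂ)‖ ≤ 1 := by
          rw [← Complex.ofReal_add, ← Complex.ofReal_sub, Complex.norm_real, Real.norm_eq_abs]
          exact abs_le.2 ⟨by linarith [ht.1, hs.2], by linarith [ht.2]⟩
        rw [norm_mul, norm_mul]
        exact mul_le_mul (hQ t ht.1.le) (mul_le_of_le_one_right (norm_nonneg _) hts)
          (by positivity) hQ₀
    _ ≤ ∫ t in x..x + 1, Q * ‖(y t).1‖ :=
        intervalIntegral.integral_mono_interval le_rfl (by linarith [hs.1]) (by linarith [hs.2])
          (.of_forall fun t => by positivity) ((hcont.const_mul Q).intervalIntegrable _ _)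

theorem norm_le_mul_integral_norm_fst (hy : IsSolution q y) (hq : Continuous q) {x Q : ℝ}
    (hQ : ∀ t ≥ x, ‖q t‖ ≤ Q) : ‖y x‖ ≤ 6 * (1 + Q) * ∫ t in x..x + 1, ‖(y t).1‖ := by
  have hshift : Continuous fun s => ‖(y (x + s)).1‖ :=
    hy.continuous.fst.norm.comp (continuous_const_add x)
  set I := ∫ t in x..x + 1, ‖(y t).1‖ with hI
  calc ‖y x‖ ≤ 6 * ∫ s in (0 : ℝ)..1, ‖(y x).1 + s * (y x).2‖ :=
        norm_le_six_mul_integral_norm_add_mul _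
    _ ≤ 6 * ∫ s in (0 : ℝ)..1, (‖(y (x + s)).1‖ + Q * I) := by
        gcongr
        exact intervalIntegral.integral_mono_on zero_le_one
          ((by fun_prop : Continuous _).intervalIntegrable _ _)
          ((hshift.add continuous_const).intervalIntegrable _ _)
          fun s hs => hy.norm_fst_add_mul_snd_le hq hQ hs
    _ = 6 * (1 + Q) * I := by
        rw [intervalIntegral.integral_add (hshift.intervalIntegrable _ _) intervalIntegrable_const,
          intervalIntegral.integral_comp_add_left (fun t => ‖(y t).1‖) x, add_zero, ← hI,
          intervalIntegral.integral_const]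
        simp only [sub_zero, smul_eq_mul]
        ring

theorem tendsto_zero_of_memLp_two (hy : IsSolution q y) (hq : Continuous q)
    (hbdd : IsBoundedUnder (· ≤ ·) atTop fun t => ‖q t‖) (hL : MemLp (fun x => (y x).1) 2) :
    Tendsto y atTop (𝓝 0) := by
  obtain ⟨Q, hQ⟩ := hbdd
  obtain ⟨a, ha⟩ := eventually_atTop.1 (eventually_map.1 hQ)
  have hlim := tendsto_intervalIntegral_unit_norm_of_memLp_two hy.continuous.fst hL
  refine squeeze_zero_norm' ?_ (by simpa using hlim.const_mul (6 * (1 + Q)))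
  filter_upwards [eventually_ge_atTop a] with x hx
  exact hy.norm_le_mul_integral_norm_fst hq fun t ht => ha t (hx.trans ht)

end IsSolution

end Decay

section Parity

namespace IsSolution

variable {q : ℝ → ℂ} {y : ℝ → ℂ × ℂ}

theorem isSelfAdjoint (hy : IsSolution q y) (hq : Continuous q) (hqs : IsSelfAdjoint q) {x₀ : ℝ}
    (h₀ : IsSelfAdjoint (y x₀)) : IsSelfAdjoint y := by
  have hstar := hy.star
  rw [hqs.star_eq] at hstar
  exact hstar.eq_of_apply_eq hy hq h₀

theorem fst_zero_eq_zero_or_snd_zero_eq_zero (hy : IsSolution q y) (hq : Continuous q)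
    (hqe : q.Even) (hlim : Tendsto y atTop (𝓝 0)) (hlim' : Tendsto (reflection y) atTop (𝓝 0)) :
    (y 0).1 = 0 ∨ (y 0).2 = 0 := by
  have h₀ := hy.wronskian_eq_zero_of_tendsto (hy.reflect hqe) hq
    (tendsto_wronskian_zero hlim hlim') 0
  simp only [wronskian, reflection, neg_zero] at h₀
  refine mul_eq_zero.1 ?_
  linear_combination -h₀ / 2

theorem even_fst (hy : IsSolution q y) (hq : Continuous q) (hqe : q.Even) (h₀ : (y 0).2 = 0) :
    Function.Even fun x => (y x).1 := fun x => by
  have hrefl := (hy.reflect hqe).eq_of_apply_eq hy hq (x₀ := 0)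
    (Prod.ext (by simp [reflection]) (by simp [reflection, h₀]))
  simpa [reflection] using congrArg Prod.fst (congrFun hrefl x)

theorem odd_fst (hy : IsSolution q y) (hq : Continuous q) (hqe : q.Even) (h₀ : (y 0).1 = 0) :
    Function.Odd fun x => (y x).1 := fun x => by
  have hrefl := (hy.reflect hqe).eq_of_apply_eq (hy.const_smul (-1)) hq (x₀ := 0)
    (Prod.ext (by simp [reflection, h₀]) (by simp [reflection]))
  simpa [reflection] using congrArg Prod.fst (congrFun hrefl x)

theorem ne_zero (hy : IsSolution q y) (hq : Continuous q) (hne : y ≠ 0) (x : ℝ) : y x ≠ 0 :=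
  fun hx => hne <| hy.eq_of_apply_eq (y := fun _ => 0)
    (fun t => (hasDerivAt_const t 0).congr_deriv (by ext <;> simp)) hq hx

theorem exists_parity_of_memLp_two (hy : IsSolution q y) (hq : Continuous q) (hqe : q.Even)
    (hbdd : IsBoundedUnder (· ≤ ·) atTop fun t => ‖q t‖) (hL : MemLp (fun x => (y x).1) 2)
    (hne : y ≠ 0) :
    ∃ a b c : ℂ, ((Function.Even (fun x => (y x).1) ∧ a = 1 ∧ b = 0) ∨
      (Function.Odd (fun x => (y x).1) ∧ a = 0 ∧ b = 1)) ∧ (a, b) = c • y 0 := by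
  have hlim := hy.tendsto_zero_of_memLp_two hq hbdd hL
  have hlim' := (hy.reflect hqe).tendsto_zero_of_memLp_two hq hbdd
    (hL.comp_measurePreserving (Measure.measurePreserving_neg volume))
  have hy₀ := hy.ne_zero hq hne 0
  rcases hy.fst_zero_eq_zero_or_snd_zero_eq_zero hq hqe hlim hlim' with h₀ | h₀
  · have h₁ : (y 0).2 ≠ 0 := fun h₁ => hy₀ (Prod.ext h₀ h₁)
    exact ⟨_, _, (y 0).2⁻¹, .inr ⟨hy.odd_fst hq hqe h₀, rfl, rfl⟩, by ext <;> simp [h₀, h₁]⟩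
  · have h₁ : (y 0).1 ≠ 0 := fun h₁ => hy₀ (Prod.ext h₁ h₀)
    exact ⟨_, _, (y 0).1⁻¹, .inl ⟨hy.even_fst hq hqe h₀, rfl, rfl⟩, by ext <;> simp [h₀, h₁]⟩

end IsSolution

end Parity

section Floquet

/-- `y` is the Cauchy data of a Floquet solution of `u'' = Q u`, of multiplier `c` over the unit
period: a nonzero solution with `u (x + 1) = c * u x`. -/
structure IsFloquetSolution (Q : ℝ → ℂ) (c : ℂ) (y : ℝ → ℂ × ℂ) : Prop where
  isSolution : IsSolution Q y
  ne_zero : y ≠ 0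
  apply_add_one (x : ℝ) : y (x + 1) = c • y x

theorem isBigO_exp_of_apply_add_one {F : Type*} [NormedAddCommGroup F] [NormedSpace ℂ F]
    {f : ℝ → F} {c : ℂ} (hf : Continuous f) (hc : c ≠ 0) (hfc : ∀ x, f (x + 1) = c • f x) :
    f =O[atTop] fun x => Real.exp (Real.log ‖c‖ * x) := by
  have hper : Function.Periodic (fun x => Real.exp (-(Real.log ‖c‖ * x)) * ‖f x‖) 1 := fun x => by
    have hc' : 0 < ‖c‖ := norm_pos_iff.2 hc
    simp only [hfc, norm_smul, mul_add, mul_one, neg_add, Real.exp_add, Real.exp_neg,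
      Real.exp_log hc']
    field_simp
  obtain ⟨C, hC⟩ := (hper.isBounded_of_continuous one_ne_zero (by fun_prop)).exists_norm_le
  refine .of_bound C (.of_forall fun x => ?_)
  have hx : Real.exp (-(Real.log ‖c‖ * x)) * ‖f x‖ ≤ C := (le_abs_self _).trans (hC _ ⟨x, rfl⟩)
  rwa [Real.exp_neg, inv_mul_le_iff₀ (Real.exp_pos _), mul_comm, ← Real.norm_of_nonneg
    (Real.exp_pos _).le] at hx

namespace IsFloquetSolution

variable {Q : ℝ → ℂ} {c : ℂ} {y : ℝ → ℂ × ℂ}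

theorem multiplier_ne_zero (hy : IsFloquetSolution Q c y) (hQ : Continuous Q) : c ≠ 0 := by
  rintro rfl
  exact hy.isSolution.ne_zero hQ hy.ne_zero (0 + 1) (by rw [hy.apply_add_one, zero_smul])

theorem reflect (hy : IsFloquetSolution Q c y) (hQ : Continuous Q) (hQe : Q.Even) :
    IsFloquetSolution Q c⁻¹ (reflection y) where
  isSolution := hy.isSolution.reflect hQe
  ne_zero h := hy.isSolution.ne_zero hQ hy.ne_zero 0 <| by
    simpa [reflection, Prod.ext_iff] using congrFun h 0
  apply_add_one x := by
    have hx := hy.apply_add_one (-(x + 1))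
    rw [neg_add, neg_add_cancel_right] at hx
    simp only [reflection, neg_add, hx]
    have := hy.multiplier_ne_zero hQ
    ext <;> simp [this]

theorem wronskian_reflect_ne_zero (hy : IsFloquetSolution Q c y) (hQ : Continuous Q)
    (hQe : Q.Even) (hc : ‖c‖ < 1) (x : ℝ) : wronskian (y x) (reflection y x) ≠ 0 := by
  intro hW
  have hr := hy.reflect hQ hQe
  have hne := hy.isSolution.ne_zero hQ hy.ne_zero
  obtain ⟨σ, hσ⟩ := exists_eq_smul_of_wronskian_eq_zero (hne x) hW
  have hrefl : reflection y = fun x => σ • y x :=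
    hr.isSolution.eq_of_apply_eq (hy.isSolution.const_smul σ) hQ hσ
  have hshift := hr.apply_add_one x
  simp only [hrefl, hy.apply_add_one, smul_smul] at hshift
  have hσ₀ : σ ≠ 0 := by
    rintro rfl
    exact hr.isSolution.ne_zero hQ hr.ne_zero x (by simp [hrefl])
  have hcc : c * c = 1 := by
    have := smul_left_injective ℂ (hne x) hshift
    have := hy.multiplier_ne_zero hQ
    field_simp at *
    linear_combination this
  have hnorm : ‖c‖ * ‖c‖ = 1 := by rw [← norm_mul, hcc, norm_one]
  nlinarith [norm_nonneg c]

theorem isBigO_exp (hy : IsFloquetSolution Q c y) (hQ : Continuous Q) (hQe : Q.Even)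
    (hc : ‖c‖ < 1) {w : ℝ → ℂ × ℂ} (hw : IsSolution Q w) :
    w =O[atTop] fun x => Real.exp (-Real.log ‖c‖ * x) := by
  have hc₀ := hy.multiplier_ne_zero hQ
  have hr := hy.reflect hQ hQe
  have hgrow : reflection y =O[atTop] fun x => Real.exp (-Real.log ‖c‖ * x) := by
    simpa using isBigO_exp_of_apply_add_one hr.isSolution.continuous (inv_ne_zero hc₀)
      hr.apply_add_one
  have hdecay : y =O[atTop] fun x => Real.exp (-Real.log ‖c‖ * x) := by
    refine (isBigO_exp_of_apply_add_one hy.isSolution.continuous hc₀ hy.apply_add_one).trans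
      (.of_bound' ?_)
    filter_upwards [eventually_ge_atTop 0] with x hx
    have hlog : Real.log ‖c‖ ≤ 0 := Real.log_nonpos (norm_nonneg c) hc.le
    rw [Real.norm_of_nonneg (Real.exp_pos _).le, Real.norm_of_nonneg (Real.exp_pos _).le]
    gcongr
    linarith
  have hω := hy.wronskian_reflect_ne_zero hQ hQe hc 0
  rw [← Asymptotics.isBigO_const_smul_left hω]
  refine ((hdecay.const_smul_left (wronskian (w 0) (reflection y 0))).sub
    (hgrow.const_smul_left (wronskian (w 0) (y 0)))).congr_left fun x => ?_
  simp only [Pi.smul_apply]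
  rw [hw.wronskian_eq_wronskian hr.isSolution hQ 0 x,
    hw.wronskian_eq_wronskian hy.isSolution hQ 0 x,
    hy.isSolution.wronskian_eq_wronskian hr.isSolution hQ 0 x, wronskian_smul_eq_sub (y x)]

end IsFloquetSolution

theorem IsSolution.exists_isFloquetSolution {Q : ℝ → ℂ} {y : ℝ → ℂ × ℂ} (hy : IsSolution Q y)
    (hQ : Continuous Q) (hQp : Q.Periodic 1) (hys : IsSelfAdjoint y) (hne : y ≠ 0)
    (hlim : Tendsto y atTop (𝓝 0)) : ∃ c : ℝ, |c| < 1 ∧ IsFloquetSolution Q c y := by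
  have hshift : IsSolution Q fun x => y (x + 1) := hy.comp_add_const hQp
  have hlim₁ : Tendsto (fun x => y (x + 1)) atTop (𝓝 0) :=
    hlim.comp (tendsto_atTop_add_const_right _ 1 tendsto_id)
  have hy₀ := hy.ne_zero hQ hne 0
  obtain ⟨c, hc⟩ := exists_eq_smul_of_wronskian_eq_zero hy₀
    (hy.wronskian_eq_zero_of_tendsto hshift hQ (tendsto_wronskian_zero hlim hlim₁) 0)
  have hmul (x : ℝ) : y (x + 1) = c • y x :=
    congrFun (hshift.eq_of_apply_eq (hy.const_smul c) hQ hc) x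
  obtain ⟨c, rfl⟩ : ∃ r : ℝ, (r : ℂ) = c := by
    have hstar : star c • y 0 = c • y 0 := by
      have hys' (x : ℝ) : star (y x) = y x := congrFun hys x
      rw [← hmul, ← hys' (0 + 1), hmul, star_smul, hys']
    exact ⟨_, Complex.conj_eq_iff_re.1 (smul_left_injective ℂ hy₀ hstar)⟩
  refine ⟨c, ?_, hy, hne, hmul⟩
  have hpow (n : ℕ) : y n = (c : ℂ) ^ n • y 0 := by
    induction n with
    | zero => simp
    | succ n ih => rw [Nat.cast_succ, hmul, ih, smul_smul, pow_succ']
  refine tendsto_pow_atTop_nhds_zero_iff.1 ?_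
  have hlim₀ := (hlim.comp tendsto_natCast_atTop_atTop).norm.div_const ‖y 0‖
  simpa [Function.comp_def, hpow, norm_smul, norm_ne_zero_iff.2 hy₀,
    ← tendsto_zero_iff_norm_tendsto_zero] using hlim₀

end Floquet

section Newton

open Metric

theorem norm_deriv_sub_deriv_le_of_norm_le {F : Type*} [NormedAddCommGroup F] [NormedSpace ℂ F]
    [CompleteSpace F] {f : ℂ → F} {c : ℂ} {R K : ℝ} (hf : DifferentiableOn ℂ f (ball c R))
    (hK : ∀ z ∈ ball c R, ‖f z‖ ≤ K) {z : ℂ} (hz : z ∈ ball c (R / 2)) :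
    ‖deriv f z - deriv f c‖ ≤ 8 * K / R ^ 2 * ‖z - c‖ := by
  have hR : 0 < R / 2 := pos_of_mem_ball hz
  have hsub : ball c (R / 2) ⊆ ball c R := ball_subset_ball (by linarith)
  have hderiv₂ : ∀ w ∈ ball c (R / 2), ‖deriv (deriv f) w‖ ≤ 8 * K / R ^ 2 := fun w hw => by
    have hball : closedBall w (R / 2) ⊆ ball c R :=
      closedBall_subset_ball' (by linarith [mem_ball.1 hw])
    have hcauchy := Complex.norm_iteratedDeriv_le_of_forall_mem_sphere_norm_le 2 hR
      ((hf.mono hball).diffContOnCl_ball subset_rfl)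
      fun z hz => hK z (hball (sphere_subset_closedBall hz))
    rw [iteratedDeriv_succ, iteratedDeriv_one] at hcauchy
    refine hcauchy.trans_eq ?_
    rw [Nat.factorial_two]
    push_cast
    field_simp
    ring
  exact (convex_ball c (R / 2)).norm_image_sub_le_of_norm_deriv_le
    (fun w hw => (hf.deriv isOpen_ball).differentiableAt (isOpen_ball.mem_nhds (hsub hw)))
    hderiv₂ (mem_ball_self hR) hz

variable {𝕜 : Type*} [RCLike 𝕜] {f : 𝕜 → 𝕜} {c D : 𝕜} {r : ℝ}

theorem norm_sub_sub_mul_le_of_norm_deriv_sub_le {η : ℝ}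
    (hf : ∀ z ∈ closedBall c r, DifferentiableAt 𝕜 f z)
    (hη : ∀ z ∈ closedBall c r, ‖deriv f z - D‖ ≤ η) {z w : 𝕜} (hz : z ∈ closedBall c r)
    (hw : w ∈ closedBall c r) : ‖f z - f w - D * (z - w)‖ ≤ η * ‖z - w‖ := by
  have hderiv : ∀ u ∈ closedBall c r,
      HasDerivWithinAt (fun u => f u - D * u) (deriv f u - D) (closedBall c r) u := fun u hu =>
    ((hf u hu).hasDerivAt.sub
      ((hasDerivAt_id u).const_mul D)).hasDerivWithinAt.congr_deriv (by simp)
  refine (congrArg norm ?_).trans_le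
    ((convex_closedBall c r).norm_image_sub_le_of_norm_hasDerivWithin_le hderiv hη hw hz)
  ring

theorem exists_root_of_norm_sub_sub_mul_le (hD : D ≠ 0) (hr : 0 ≤ r)
    (hf : ∀ z ∈ closedBall c r, ∀ w ∈ closedBall c r,
      ‖f z - f w - D * (z - w)‖ ≤ ‖D‖ / 2 * ‖z - w‖) (hfc : 2 * ‖f c‖ ≤ ‖D‖ * r) :
    ∃ z ∈ closedBall c r, f z = 0 := by
  let D' : 𝕜 →L[𝕜] 𝕜 := ContinuousLinearMap.mul 𝕜 𝕜 D
  let D'inv : D'.NonlinearRightInverse :=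
    { toFun := fun y => D⁻¹ * y
      nnnorm := ‖D‖₊⁻¹
      bound' := fun y => by simp
      right_inv' := fun y => mul_inv_cancel_left₀ hD y }
  have happrox : ApproximatesLinearOn f D' (closedBall c r) (‖D‖₊ / 2) := by
    simpa [ApproximatesLinearOn, D'] using hf
  refine happrox.surjOn_closedBall_of_nonlinearRightInverse D'inv hr subset_rfl ?_
  simp only [mem_closedBall, dist_zero_left, D'inv]
  push_cast
  rw [inv_inv]
  linarith

theorem exists_unique_root_of_norm_deriv_sub_le {L : ℝ} (hL : 0 ≤ L)
    (hf : ∀ z ∈ closedBall c r, DifferentiableAt 𝕜 f z)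
    (hderiv : ∀ z ∈ closedBall c r, ‖deriv f z - deriv f c‖ ≤ L * ‖z - c‖)
    (hD : deriv f c ≠ 0) (hLr : 2 * (L * r) ≤ ‖deriv f c‖)
    (hfc : 2 * ‖f c‖ ≤ ‖deriv f c‖ * r) :
    ∃ zs, ‖zs - c‖ ≤ r ∧ f zs = 0 ∧ (∀ w, ‖w - c‖ ≤ r → f w = 0 → w = zs) ∧
      ‖zs - (c - f c / deriv f c)‖ ≤ 4 * L * ‖f c‖ ^ 2 / ‖deriv f c‖ ^ 3 := by
  set D := deriv f c
  have hD₀ : 0 < ‖D‖ := norm_pos_iff.2 hD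
  set t := 2 * ‖f c‖ / ‖D‖ with ht
  have ht₀ : 0 ≤ t := by positivity
  have htr : t ≤ r := (div_le_iff₀' hD₀).2 hfc
  have happrox {s : ℝ} (hs : s ≤ r) : ∀ z ∈ closedBall c s, ∀ w ∈ closedBall c s,
      ‖f z - f w - D * (z - w)‖ ≤ L * s * ‖z - w‖ := fun z hz w hw => by
    have hsub : closedBall c s ⊆ closedBall c r := closedBall_subset_closedBall hs
    refine norm_sub_sub_mul_le_of_norm_deriv_sub_le (fun u hu => hf u (hsub hu)) (fun u hu => ?_)
      hz hw
    exact (hderiv u (hsub hu)).trans (by gcongr; exact mem_closedBall_iff_norm.1 hu)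
  have hhalf {s : ℝ} (hs : s ≤ r) : L * s ≤ ‖D‖ / 2 := by
    have : L * s ≤ L * r := by gcongr
    linarith
  obtain ⟨zs, hzs, hroot⟩ := exists_root_of_norm_sub_sub_mul_le hD ht₀
    (fun z hz w hw => (happrox htr z hz w hw).trans (by gcongr; exact hhalf htr))
    (by rw [ht]; field_simp; rfl)
  have hzst : ‖zs - c‖ ≤ t := mem_closedBall_iff_norm.1 hzs
  refine ⟨zs, hzst.trans htr, hroot, fun w hw hfw => ?_, ?_⟩
  · have hdiff := happrox le_rfl w (mem_closedBall_iff_norm.2 hw) zs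
      (mem_closedBall_iff_norm.2 (hzst.trans htr))
    rw [hfw, hroot, sub_self, zero_sub, norm_neg, norm_mul] at hdiff
    have hcontr : ‖D‖ * ‖w - zs‖ ≤ ‖D‖ / 2 * ‖w - zs‖ := hdiff.trans (by gcongr; exact hhalf le_rfl)
    have : ‖w - zs‖ ≤ 0 := by nlinarith
    exact sub_eq_zero.1 (norm_le_zero_iff.1 this)
  · have hdiff := happrox htr zs hzs c (mem_closedBall_self ht₀)
    have heq : zs - (c - f c / D) = -(f zs - f c - D * (zs - c)) / D := by
      rw [hroot]; field_simp; ring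
    rw [heq, norm_div, norm_neg, div_le_iff₀ hD₀]
    calc ‖f zs - f c - D * (zs - c)‖ ≤ L * t * t := hdiff.trans (by gcongr)
      _ = 4 * L * ‖f c‖ ^ 2 / ‖D‖ ^ 3 * ‖D‖ := by rw [ht]; field_simp; ring

end Newton

section SpectralParameter

theorem le_integral_mul_exp_of_hasDerivAt_le {J J' g : ℝ → ℝ} {L X : ℝ} (hg : Continuous g)
    (hg₀ : ∀ x, 0 ≤ g x) (hJ : ∀ x, HasDerivAt J (J' x) x) (hJ₀ : J 0 ≤ 0) (hL : 0 ≤ L)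
    (hX : 0 ≤ X) (hJ' : ∀ x ∈ Set.Icc 0 X, J' x ≤ g x + L * J x) :
    J X ≤ (∫ t in (0 : ℝ)..X, g t) * Real.exp (L * X) := by
  have hderiv (x : ℝ) : HasDerivAt (fun x => J x * Real.exp (-(L * x)))
      ((J' x - L * J x) * Real.exp (-(L * x))) x :=
    ((hJ x).mul ((hasDerivAt_id' x).const_mul L).fun_neg.exp).congr_deriv (by ring)
  have hle : J X * Real.exp (-(L * X)) - J 0 * Real.exp (-(L * 0)) ≤ ∫ t in (0 : ℝ)..X, g t := by
    refine intervalIntegral.sub_le_integral_of_hasDeriv_right_of_le hX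
      (fun x _ => (hderiv x).continuousAt.continuousWithinAt)
      (fun x _ => (hderiv x).hasDerivWithinAt) hg.continuousOn.integrableOn_Icc fun x hx => ?_
    have hexp : Real.exp (-(L * x)) ≤ 1 :=
      Real.exp_le_one_iff.2 (neg_nonpos.2 (mul_nonneg hL hx.1.le))
    calc (J' x - L * J x) * Real.exp (-(L * x)) ≤ g x * Real.exp (-(L * x)) := by
          gcongr
          linarith [hJ' x (Set.Ioo_subset_Icc_self hx)]
      _ ≤ g x := mul_le_of_le_one_right (hg₀ x) hexp
  rw [← div_le_iff₀ (Real.exp_pos _), div_eq_mul_inv, ← Real.exp_neg]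
  simpa using hle.trans'
    (sub_le_sub_left (mul_nonpos_of_nonpos_of_nonneg hJ₀ (Real.exp_pos _).le) _)

/-- The solutions `u_z` of `u'' = (q - z) u` with Cauchy data `v` at the origin, as a family indexed
by the spectral parameter `z`; `Y z = (u_z, u_z')`. -/
structure IsSolutionFamily (q : ℝ → ℂ) (v : ℂ × ℂ) (Y : ℂ → ℝ → ℂ × ℂ) : Prop where
  isSolution (z : ℂ) : IsSolution (fun x => q x - z) (Y z)
  apply_zero (z : ℂ) : Y z 0 = v

namespace IsSolutionFamily

variable {q : ℝ → ℂ} {v : ℂ × ℂ} {Y : ℂ → ℝ → ℂ × ℂ} {z₀ : ℂ} {p r : ℝ → ℂ × ℂ} {X : ℝ}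

theorem exists_of_continuous (hq : Continuous q) (v : ℂ × ℂ) : ∃ Y, IsSolutionFamily q v Y := by
  choose Y hY hY₀ using fun z : ℂ =>
    IsSolution.exists_apply_eq (hq.sub (continuous_const (y := z))) 0 v
  exact ⟨Y, hY, hY₀⟩

protected theorem star (h : IsSolutionFamily q v Y) (hq : Continuous q) (hqs : IsSelfAdjoint q)
    (hv : IsSelfAdjoint v) (z : ℂ) : star (Y z) = Y (star z) := by
  have hstar : IsSolution (fun x => q x - star z) (star (Y z)) := by
    have hq' : star (fun x => q x - z) = fun x => q x - star z := funext fun x => by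
      simpa using congrFun hqs.star_eq x
    exact hq' ▸ (h.isSolution z).star
  refine hstar.eq_of_apply_eq (h.isSolution _) (by fun_prop) (x₀ := 0) ?_
  rw [Pi.star_apply, h.apply_zero, h.apply_zero, hv.star_eq]

/-- Variation of constants: the Wronskians of `Y z - Y z₀` with `p` and `r` are given by Green's
formula and determine `Y z - Y z₀`. -/
theorem sub_eq (h : IsSolutionFamily q v Y) (hq : Continuous q)
    (hp : IsSolution (fun x => q x - z₀) p) (hr : IsSolution (fun x => q x - z₀) r)
    (hW : wronskian (p 0) (r 0) = 1) (z : ℂ) (x : ℝ) :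
    Y z x - Y z₀ x = (z - z₀) • ((∫ t in (0 : ℝ)..x, (Y z t).1 * (r t).1) • p x -
      (∫ t in (0 : ℝ)..x, (Y z t).1 * (p t).1) • r x) := by
  have hq' (z : ℂ) : Continuous fun x => q x - z := by fun_prop
  have hgreen {w : ℝ → ℂ × ℂ} (hw : IsSolution (fun x => q x - z₀) w) :
      wronskian (Y z x - Y z₀ x) (w x) = (z - z₀) * ∫ t in (0 : ℝ)..x, (Y z t).1 * (w t).1 := by
    have h₁ := (h.isSolution z).wronskian_sub_wronskian_eq_integral hw (hq' z) (hq' z₀) 0 x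
    have h₀ := (h.isSolution z₀).wronskian_eq_wronskian hw (hq' z₀) 0 x
    simp only [sub_sub_sub_cancel_left, intervalIntegral.integral_const_mul, h.apply_zero] at h₁ h₀
    rw [← h₁, h₀]
    simp only [wronskian, Prod.fst_sub, Prod.snd_sub]
    ring
  have hsplit := wronskian_smul_eq_sub (p x) (r x) (Y z x - Y z₀ x)
  rw [← hp.wronskian_eq_wronskian hr (hq' z₀) 0 x, hW, one_smul, hgreen hp, hgreen hr] at hsplit
  rw [hsplit, smul_sub, smul_smul, smul_smul]

theorem norm_sub_le_mul_integral (h : IsSolutionFamily q v Y) (hq : Continuous q)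
    (hp : IsSolution (fun x => q x - z₀) p) (hr : IsSolution (fun x => q x - z₀) r)
    (hW : wronskian (p 0) (r 0) = 1) {κ K : ℝ} (hκ : 0 ≤ κ) (hX : 0 ≤ X)
    (hpK : ∀ x ∈ Set.Icc 0 X, ‖p x‖ ≤ K * Real.exp (-(κ * x)))
    (hrK : ∀ x ∈ Set.Icc 0 X, ‖r x‖ ≤ K * Real.exp (κ * x)) (z : ℂ) :
    ‖Y z X - Y z₀ X‖ ≤ 2 * K ^ 2 * ‖z - z₀‖ * Real.exp (κ * X) *
      ∫ t in (0 : ℝ)..X, ‖(Y z t).1‖ * Real.exp (-(κ * t)) := by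
  have hYc := (h.isSolution z).continuous
  have hK : 0 ≤ K := by simpa using (norm_nonneg _).trans (hpK 0 ⟨le_rfl, hX⟩)
  have hintegral {s : ℝ → ℂ × ℂ} {B : ℝ}
      (hs : ∀ t ∈ Set.Icc 0 X, ‖s t‖ ≤ B * Real.exp (-(κ * t))) :
      ‖∫ t in (0 : ℝ)..X, (Y z t).1 * (s t).1‖ ≤
        B * ∫ t in (0 : ℝ)..X, ‖(Y z t).1‖ * Real.exp (-(κ * t)) := by
    rw [← intervalIntegral.integral_const_mul]
    refine intervalIntegral.norm_integral_le_of_norm_le hX (.of_forall fun t ht => ?_)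
      ((by fun_prop : Continuous _).intervalIntegrable _ _)
    rw [norm_mul, mul_left_comm]
    gcongr
    exact (norm_fst_le _).trans (hs t (Set.Ioc_subset_Icc_self ht))
  have hr' : ∀ t ∈ Set.Icc 0 X, ‖r t‖ ≤ K * Real.exp (2 * (κ * X)) * Real.exp (-(κ * t)) :=
    fun t ht => (hrK t ht).trans <| by
      rw [mul_assoc, ← Real.exp_add]
      gcongr
      linarith [mul_le_mul_of_nonneg_left ht.2 hκ]
  set J := ∫ t in (0 : ℝ)..X, ‖(Y z t).1‖ * Real.exp (-(κ * t))
  have hXX : X ∈ Set.Icc 0 X := ⟨hX, le_rfl⟩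
  rw [h.sub_eq hq hp hr hW, norm_smul]
  calc _ ≤ ‖z - z₀‖ * (K * Real.exp (2 * (κ * X)) * J * (K * Real.exp (-(κ * X))) +
        K * J * (K * Real.exp (κ * X))) := by
        refine mul_le_mul_of_nonneg_left ((norm_sub_le _ _).trans ?_) (norm_nonneg _)
        rw [norm_smul, norm_smul]
        have hJ₀ : 0 ≤ J := intervalIntegral.integral_nonneg hX fun t _ => by positivity
        gcongr
        exacts [hintegral hr', hpK X hXX, hintegral hpK, hrK X hXX]
    _ = _ := by
        rw [two_mul (κ * X), Real.exp_add, Real.exp_neg]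
        field_simp
        ring

theorem norm_sub_le (h : IsSolutionFamily q v Y) (hq : Continuous q)
    (hp : IsSolution (fun x => q x - z₀) p) (hr : IsSolution (fun x => q x - z₀) r)
    (hW : wronskian (p 0) (r 0) = 1) {κ K : ℝ} (hκ : 0 ≤ κ) (hX : 0 ≤ X)
    (hpK : ∀ x ∈ Set.Icc 0 X, ‖p x‖ ≤ K * Real.exp (-(κ * x)))
    (hrK : ∀ x ∈ Set.Icc 0 X, ‖r x‖ ≤ K * Real.exp (κ * x)) (z : ℂ) :
    ‖Y z X - Y z₀ X‖ ≤ 2 * K ^ 2 * ‖z - z₀‖ * Real.exp (κ * X) *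
      ((∫ t in (0 : ℝ)..X, ‖(Y z₀ t).1‖ * Real.exp (-(κ * t))) *
        Real.exp (2 * K ^ 2 * ‖z - z₀‖ * X)) := by
  have hYc (z : ℂ) := (h.isSolution z).continuous
  have hbound {x : ℝ} (hx : x ∈ Set.Icc 0 X) :=
    h.norm_sub_le_mul_integral hq hp hr hW hκ hx.1 (fun t ht => hpK t ⟨ht.1, ht.2.trans hx.2⟩)
      (fun t ht => hrK t ⟨ht.1, ht.2.trans hx.2⟩) z
  refine (hbound ⟨hX, le_rfl⟩).trans ?_
  gcongr
  have hc (z : ℂ) : Continuous fun t => ‖(Y z t).1‖ * Real.exp (-(κ * t)) := by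
    have := hYc z
    fun_prop
  refine le_integral_mul_exp_of_hasDerivAt_le (hc z₀) (fun t => by positivity)
    (fun t => (hc z).integral_hasStrictDerivAt 0 t |>.hasDerivAt) (by simp) (by positivity) hX
    fun x hx => ?_
  have htri : ‖(Y z x).1‖ ≤ ‖(Y z₀ x).1‖ + ‖Y z x - Y z₀ x‖ :=
    (norm_le_norm_add_norm_sub' _ _).trans (by gcongr; exact norm_fst_le (Y z x - Y z₀ x))
  calc ‖(Y z x).1‖ * Real.exp (-(κ * x))
      ≤ (‖(Y z₀ x).1‖ + 2 * K ^ 2 * ‖z - z₀‖ * Real.exp (κ * x) *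
        ∫ t in (0 : ℝ)..x, ‖(Y z t).1‖ * Real.exp (-(κ * t))) * Real.exp (-(κ * x)) := by
        gcongr
        exact htri.trans (by gcongr; exact hbound hx)
    _ = _ := by
        rw [Real.exp_neg]
        field_simp

theorem exists_forall_norm_sub_le (h : IsSolutionFamily q v Y) (hq : Continuous q) (z₀ : ℂ)
    (X : ℝ) :
    ∃ C, ∀ z, ‖z - z₀‖ ≤ 1 → ∀ x ∈ Set.Icc 0 X, ‖Y z x - Y z₀ x‖ ≤ C * ‖z - z₀‖ := by
  have hq₀ : Continuous fun x => q x - z₀ := by fun_prop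
  obtain ⟨p, hp, hp₀⟩ := IsSolution.exists_apply_eq hq₀ 0 (1, 0)
  obtain ⟨r, hr, hr₀⟩ := IsSolution.exists_apply_eq hq₀ 0 (0, 1)
  obtain ⟨K₁, hK₁⟩ :=
    isCompact_Icc.exists_bound_of_continuousOn (s := Set.Icc 0 X) hp.continuous.continuousOn
  obtain ⟨K₂, hK₂⟩ :=
    isCompact_Icc.exists_bound_of_continuousOn (s := Set.Icc 0 X) hr.continuous.continuousOn
  set K := max K₁ K₂
  have hY := (h.isSolution z₀).continuous
  refine ⟨2 * K ^ 2 * ((∫ t in (0 : ℝ)..X, ‖(Y z₀ t).1‖) * Real.exp (2 * K ^ 2 * X)),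
    fun z hz x hx => ?_⟩
  have hle := h.norm_sub_le hq hp hr (by simp [hp₀, hr₀, wronskian]) le_rfl hx.1 (K := K)
    (fun t ht => by simpa [K] using Or.inl (hK₁ t ⟨ht.1, ht.2.trans hx.2⟩))
    (fun t ht => by simpa [K] using Or.inr (hK₂ t ⟨ht.1, ht.2.trans hx.2⟩)) z
  simp only [zero_mul, neg_zero, Real.exp_zero, mul_one] at hle
  refine hle.trans ?_
  rw [mul_right_comm]
  have hmono : ∫ t in (0 : ℝ)..x, ‖(Y z₀ t).1‖ ≤ ∫ t in (0 : ℝ)..X, ‖(Y z₀ t).1‖ :=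
    intervalIntegral.integral_mono_interval le_rfl hx.1 hx.2 (.of_forall fun t => norm_nonneg _)
      ((by fun_prop : Continuous _).intervalIntegrable _ _)
  have hnonneg : 0 ≤ ∫ t in (0 : ℝ)..X, ‖(Y z₀ t).1‖ :=
    intervalIntegral.integral_nonneg (hx.1.trans hx.2) fun t _ => norm_nonneg _
  have hexp : 2 * K ^ 2 * ‖z - z₀‖ * x ≤ 2 * K ^ 2 * X :=
    mul_le_mul (mul_le_of_le_one_right (by positivity) hz) hx.2 hx.1 (by positivity)
  gcongr

theorem tendsto_integral_fst_mul (h : IsSolutionFamily q v Y) (hq : Continuous q) (z₀ : ℂ)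
    (hX : 0 ≤ X) {s : ℝ → ℂ} (hs : Continuous s) :
    Tendsto (fun z => ∫ t in (0 : ℝ)..X, (Y z t).1 * s t) (𝓝 z₀)
      (𝓝 (∫ t in (0 : ℝ)..X, (Y z₀ t).1 * s t)) := by
  obtain ⟨C, hC⟩ := h.exists_forall_norm_sub_le hq z₀ X
  have hYc (z : ℂ) := (h.isSolution z).continuous
  have hnear : ∀ᶠ z in 𝓝 z₀, ∀ t ∈ Set.Icc 0 X, ‖(Y z t).1 - (Y z₀ t).1‖ ≤ C * ‖z - z₀‖ := by
    filter_upwards [Metric.closedBall_mem_nhds z₀ one_pos] with z hz t ht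
    exact (norm_fst_le (Y z t - Y z₀ t)).trans (hC z (mem_closedBall_iff_norm.1 hz) t ht)
  rw [tendsto_iff_norm_sub_tendsto_zero]
  have hlim : Tendsto (fun z => C * ‖z - z₀‖ * ∫ t in (0 : ℝ)..X, ‖s t‖) (𝓝 z₀) (𝓝 0) := by
    have : Continuous fun z => C * ‖z - z₀‖ * ∫ t in (0 : ℝ)..X, ‖s t‖ := by fun_prop
    simpa using this.tendsto z₀
  refine squeeze_zero' (.of_forall fun z => norm_nonneg _) (hnear.mono fun z hz => ?_) hlim
  rw [← intervalIntegral.integral_sub ((by fun_prop : Continuous _).intervalIntegrable _ _)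
    ((by fun_prop : Continuous _).intervalIntegrable _ _), ← intervalIntegral.integral_const_mul]
  refine intervalIntegral.norm_integral_le_of_norm_le hX (.of_forall fun t ht => ?_)
    ((by fun_prop : Continuous _).intervalIntegrable _ _)
  rw [← sub_mul, norm_mul]
  gcongr
  exact hz t (Set.Ioc_subset_Icc_self ht)

theorem hasDerivAt (h : IsSolutionFamily q v Y) (hq : Continuous q)
    (hp : IsSolution (fun x => q x - z₀) p) (hr : IsSolution (fun x => q x - z₀) r)
    (hW : wronskian (p 0) (r 0) = 1) (hX : 0 ≤ X) :
    HasDerivAt (fun z => Y z X) ((∫ t in (0 : ℝ)..X, (Y z₀ t).1 * (r t).1) • p X -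
      (∫ t in (0 : ℝ)..X, (Y z₀ t).1 * (p t).1) • r X) z₀ := by
  rw [hasDerivAt_iff_tendsto_slope]
  have hpc := hp.continuous
  have hrc := hr.continuous
  have hlim := ((h.tendsto_integral_fst_mul hq z₀ hX (by fun_prop : Continuous fun t => (r t).1)
    ).smul_const (p X)).sub
    ((h.tendsto_integral_fst_mul hq z₀ hX (by fun_prop : Continuous fun t => (p t).1)
    ).smul_const (r X))
  refine (hlim.mono_left nhdsWithin_le_nhds).congr' ?_
  filter_upwards [self_mem_nhdsWithin] with z hz
  rw [slope_def_module, h.sub_eq hq hp hr hW, inv_smul_smul₀ (sub_ne_zero.2 hz)]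

theorem differentiable (h : IsSolutionFamily q v Y) (hq : Continuous q) (hX : 0 ≤ X) :
    Differentiable ℂ fun z => Y z X := fun z₀ => by
  have hq₀ : Continuous fun x => q x - z₀ := by fun_prop
  obtain ⟨p, hp, hp₀⟩ := IsSolution.exists_apply_eq hq₀ 0 (1, 0)
  obtain ⟨r, hr, hr₀⟩ := IsSolution.exists_apply_eq hq₀ 0 (0, 1)
  exact (h.hasDerivAt hq hp hr (by simp [hp₀, hr₀, wronskian]) hX).differentiableAt

theorem wronskian_deriv (h : IsSolutionFamily q v Y) (hq : Continuous q) (hv : v ≠ 0) (z : ℂ)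
    (hX : 0 ≤ X) :
    wronskian (Y z X) (deriv (fun z => Y z X) z) = -∫ t in (0 : ℝ)..X, (Y z t).1 ^ 2 := by
  have hq' : Continuous fun x => q x - z := by fun_prop
  obtain ⟨w, hw⟩ := exists_wronskian_eq_one hv
  obtain ⟨r, hr, hr₀⟩ := IsSolution.exists_apply_eq hq' 0 w
  have hW : wronskian (Y z 0) (r 0) = 1 := by rw [h.apply_zero, hr₀, hw]
  rw [(h.hasDerivAt hq (h.isSolution z) hr hW hX).deriv]
  rw [(h.isSolution z).wronskian_eq_wronskian hr hq' 0 X] at hW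
  simp only [pow_two]
  simp only [wronskian, Prod.fst_sub, Prod.snd_sub, Prod.smul_fst, Prod.smul_snd,
    smul_eq_mul] at hW ⊢
  linear_combination -(∫ t in (0 : ℝ)..X, (Y z t).1 * (Y z t).1) * hW

end IsSolutionFamily

end SpectralParameter

section OutgoingCondition

/-- The boundary form `u' - i σ u` of the Cauchy data `w = (u, u')`, which vanishes on the outgoing
wave `e^{iσx}`. -/
noncomputable def outgoingForm (σ : ℂ) (w : ℂ × ℂ) : ℂ := w.2 - Complex.I * σ * w.1

theorem norm_outgoingForm_le (σ : ℂ) (w : ℂ × ℂ) : ‖outgoingForm σ w‖ ≤ (1 + ‖σ‖) * ‖w‖ := by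
  calc ‖outgoingForm σ w‖ ≤ ‖w.2‖ + ‖Complex.I * σ * w.1‖ := norm_sub_le _ _
    _ ≤ ‖w‖ + ‖σ‖ * ‖w‖ := by
        rw [norm_mul, norm_mul, Complex.norm_I, one_mul]
        gcongr
        exacts [norm_snd_le w, norm_fst_le w]
    _ = (1 + ‖σ‖) * ‖w‖ := by ring

theorem outgoingForm_sub_outgoingForm (σ τ : ℂ) (v w : ℂ × ℂ) :
    outgoingForm σ v - outgoingForm τ w =
      outgoingForm σ (v - w) - Complex.I * (σ - τ) * w.1 := by
  simp only [outgoingForm, Prod.fst_sub, Prod.snd_sub]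
  ring

theorem norm_le_mul_norm_outgoingForm {w : ℂ × ℂ} (hw : IsSelfAdjoint w) {s : ℝ} (hs : 0 < s) :
    ‖w‖ ≤ (1 + 1 / s) * ‖outgoingForm s w‖ := by
  obtain ⟨a, ha⟩ := Complex.conj_eq_iff_real.1 (congrArg Prod.fst hw)
  obtain ⟨b, hb⟩ := Complex.conj_eq_iff_real.1 (congrArg Prod.snd hw)
  have hb' : |b| ≤ ‖outgoingForm s w‖ := by
    simpa [outgoingForm, ha, hb] using Complex.abs_re_le_norm (outgoingForm s w)
  have ha' : s * |a| ≤ ‖outgoingForm s w‖ := by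
    simpa [outgoingForm, ha, hb, abs_mul, abs_of_pos hs]
      using Complex.abs_im_le_norm (outgoingForm s w)
  refine max_le ?_ ?_
  · rw [ha, Complex.norm_real, Real.norm_eq_abs, add_mul, one_mul, one_div_mul_eq_div]
    exact ((le_div_iff₀' hs).2 ha').trans (le_add_of_nonneg_left (norm_nonneg _))
  · rw [hb, Complex.norm_real, Real.norm_eq_abs]
    exact hb'.trans (le_mul_of_one_le_left (norm_nonneg _) (by simp [hs.le]))

variable {E : ℝ} {z : ℂ}

theorem sqrt_ofReal_of_nonneg (hE : 0 ≤ E) : Complex.sqrt E = √E := by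
  rw [Complex.sqrt_of_nonneg (by exact_mod_cast hE), Complex.ofReal_re]

theorem mem_slitPlane_of_mem_ball (hz : z ∈ Metric.ball (E : ℂ) E) : z ∈ Complex.slitPlane := by
  have := (Complex.abs_re_le_norm (z - E)).trans_lt (mem_ball_iff_norm.1 hz)
  rw [Complex.sub_re, Complex.ofReal_re] at this
  exact .inl (by linarith [(abs_lt.1 this).1])

theorem norm_sqrt_sub_sqrt_le (hE : 0 < E) (z : ℂ) :
    ‖Complex.sqrt z - Complex.sqrt E‖ ≤ ‖z - E‖ / √E := by
  have hsq (w : ℂ) : Complex.sqrt w ^ 2 = w := by simp [Complex.sqrt]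
  have hre : √E ≤ ‖Complex.sqrt z + Complex.sqrt E‖ := by
    refine le_trans ?_ (Complex.re_le_norm _)
    rw [sqrt_ofReal_of_nonneg hE.le, Complex.add_re, Complex.ofReal_re, Complex.sqrt,
      Complex.cpow_inv_two_re]
    exact le_add_of_nonneg_left (Real.sqrt_nonneg _)
  rw [le_div_iff₀ (Real.sqrt_pos.2 hE)]
  calc _ ≤ ‖Complex.sqrt z - Complex.sqrt E‖ * ‖Complex.sqrt z + Complex.sqrt E‖ := by gcongr
    _ = ‖z - E‖ := by
      rw [← norm_mul]
      congr 1
      linear_combination hsq z - hsq E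

theorem norm_outgoingForm_sqrt_sub_le (hE : 0 < E) (hz : ‖z - E‖ ≤ E) (v w : ℂ × ℂ) :
    ‖outgoingForm (Complex.sqrt z) v - outgoingForm (Complex.sqrt E) w‖ ≤
      (1 + 2 * √E) * ‖v - w‖ + ‖z - E‖ / √E * ‖w‖ := by
  have hsub := norm_sqrt_sub_sqrt_le hE z
  have hnorm : ‖Complex.sqrt z‖ ≤ 2 * √E := by
    have hE' : ‖Complex.sqrt E‖ = √E := by
      rw [sqrt_ofReal_of_nonneg hE.le, Complex.norm_real, Real.norm_of_nonneg (Real.sqrt_nonneg E)]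
    calc ‖Complex.sqrt z‖ ≤ ‖Complex.sqrt E‖ + ‖Complex.sqrt z - Complex.sqrt E‖ :=
          norm_le_norm_add_norm_sub' _ _
      _ ≤ √E + E / √E := by
          rw [hE']
          gcongr
          exact hsub.trans (by gcongr)
      _ = 2 * √E := by rw [Real.div_sqrt, two_mul]
  rw [outgoingForm_sub_outgoingForm]
  refine (norm_sub_le _ _).trans (add_le_add ((norm_outgoingForm_le _ _).trans (by gcongr)) ?_)
  rw [norm_mul, norm_mul, Complex.norm_I, one_mul]
  gcongr
  exact norm_fst_le w

end OutgoingCondition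

namespace IsSolutionFamily

variable {q : ℝ → ℂ} {v : ℂ × ℂ} {Y : ℂ → ℝ → ℂ × ℂ} {E M : ℝ}

theorem outgoingTheta_eq (h : IsSolutionFamily q v Y) (M : ℝ) :
    outgoingTheta (fun z x => (Y z x).1) M =
      fun z => outgoingForm (Complex.sqrt z) (Y z M) := funext fun z => by
  rw [outgoingTheta, ((h.isSolution z).hasDerivAt_fst M).deriv, outgoingForm]

theorem differentiableAt_outgoingTheta (h : IsSolutionFamily q v Y) (hq : Continuous q)
    (hM : 0 ≤ M) {z : ℂ} (hz : z ∈ Complex.slitPlane) :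
    DifferentiableAt ℂ (outgoingTheta (fun z x => (Y z x).1) M) z := by
  rw [h.outgoingTheta_eq]
  have hY := h.differentiable hq hM z
  have := Complex.differentiableAt_sqrt hz
  unfold outgoingForm
  fun_prop

theorem deriv_outgoingTheta (h : IsSolutionFamily q v Y) (hq : Continuous q) (hM : 0 ≤ M)
    {z : ℂ} (hz : z ∈ Complex.slitPlane) :
    deriv (outgoingTheta (fun z x => (Y z x).1) M) z =
      outgoingForm (Complex.sqrt z) (deriv (fun z => Y z M) z) -
        Complex.I * deriv Complex.sqrt z * (Y z M).1 := by
  have hY := (h.differentiable hq hM z).hasDerivAt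
  have hsqrt := (Complex.differentiableAt_sqrt hz).hasDerivAt
  have hfst := (hasFDerivAt_fst (𝕜 := ℂ) (p := Y z M)).comp_hasDerivAt z hY
  have hsnd := (hasFDerivAt_snd (𝕜 := ℂ) (p := Y z M)).comp_hasDerivAt z hY
  rw [h.outgoingTheta_eq]
  refine ((hsnd.sub ((hsqrt.const_mul Complex.I).mul hfst)).congr_deriv ?_).deriv
  simp only [outgoingForm, Function.comp_apply, ContinuousLinearMap.coe_fst',
    ContinuousLinearMap.coe_snd']
  ring

theorem isSelfAdjoint_apply (h : IsSolutionFamily q v Y) (hq : Continuous q)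
    (hqs : IsSelfAdjoint q) (hv : IsSelfAdjoint v) (E x : ℝ) : IsSelfAdjoint (Y E x) := by
  have hstar := congrFun (h.star hq hqs hv E) x
  rw [show star (E : ℂ) = E from Complex.conj_ofReal E] at hstar
  exact hstar

theorem isSelfAdjoint_deriv (h : IsSolutionFamily q v Y) (hq : Continuous q)
    (hqs : IsSelfAdjoint q) (hv : IsSelfAdjoint v) (E : ℝ) (hM : 0 ≤ M) :
    IsSelfAdjoint (deriv (fun z => Y z M) (E : ℂ)) := by
  have hreal : HasDerivAt (fun t : ℝ => Y t M) (deriv (fun z => Y z M) (E : ℂ)) E := by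
    simpa [Function.comp_def] using
      ((h.differentiable hq hM E).hasDerivAt).scomp E Complex.ofRealCLM.hasDerivAt
  have hstar := hreal.star
  simp only [(h.isSelfAdjoint_apply hq hqs hv _ M).star_eq] at hstar
  exact hstar.unique hreal

end IsSolutionFamily

section ResonanceBounds

theorem IsSolution.exists_fst_ne_zero {q : ℝ → ℂ} {y : ℝ → ℂ × ℂ} (hy : IsSolution q y)
    (hq : Continuous q) (hne : y ≠ 0) {a b : ℝ} (hab : a < b) :
    ∃ x ∈ Set.Icc a b, (y x).1 ≠ 0 := by
  by_contra! hzero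
  obtain ⟨m, hm⟩ := exists_between hab
  have hev : (fun x => (y x).1) =ᶠ[𝓝 m] fun _ => 0 := by
    filter_upwards [Icc_mem_nhds hm.1 hm.2] with x hx using hzero x hx
  have hsnd : (y m).2 = 0 :=
    (hy.hasDerivAt_fst m).unique ((hasDerivAt_const m 0).congr_of_eventuallyEq hev)
  exact hy.ne_zero hq hne m (Prod.ext hev.self_of_nhds hsnd)

namespace IsSolutionFamily

variable {q : ℝ → ℂ} {v : ℂ × ℂ} {Y : ℂ → ℝ → ℂ × ℂ} {E κ : ℝ}

theorem exists_pos_forall_le_norm_wronskian_deriv (h : IsSolutionFamily q v Y) (hq : Continuous q)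
    (hqs : IsSelfAdjoint q) (hv : IsSelfAdjoint v) (hv₀ : v ≠ 0) (E : ℝ) :
    ∃ J > 0, ∀ M ≥ 1, J ≤ ‖wronskian (Y E M) (deriv (fun z => Y z M) E)‖ := by
  have hY := h.isSolution E
  have hYc := hY.continuous
  have hreal (t : ℝ) : (Y E t).1 = ((Y E t).1.re : ℂ) :=
    (Complex.conj_eq_iff_re.1 (congrArg Prod.fst (h.isSelfAdjoint_apply hq hqs hv E t))).symm
  have hint (a b : ℝ) : IntervalIntegrable (fun t => (Y E t).1.re ^ 2) volume a b :=
    (by fun_prop : Continuous _).intervalIntegrable _ _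
  refine ⟨∫ t in (0 : ℝ)..1, (Y E t).1.re ^ 2, ?_, fun M hM => ?_⟩
  · obtain ⟨x, hx, hne⟩ := hY.exists_fst_ne_zero (by fun_prop)
      (fun h₀ => hv₀ (by rw [← h.apply_zero E, h₀, Pi.zero_apply])) one_pos
    refine intervalIntegral.integral_pos one_pos (by fun_prop) (fun t _ => sq_nonneg _)
      ⟨x, hx, ?_⟩
    rw [hreal, Complex.ofReal_ne_zero] at hne
    positivity
  · have hcast : ∫ t in (0 : ℝ)..M, (Y E t).1 ^ 2 =
        ((∫ t in (0 : ℝ)..M, (Y E t).1.re ^ 2 : ℝ) : ℂ) := by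
      rw [← intervalIntegral.integral_ofReal]
      simp only [Complex.ofReal_pow, ← hreal]
    rw [h.wronskian_deriv hq hv₀ E (zero_le_one.trans hM), norm_neg, hcast, Complex.norm_real]
    exact (intervalIntegral.integral_mono_interval le_rfl zero_le_one hM
      (.of_forall fun t => sq_nonneg _) (hint 0 M)).trans (le_abs_self _)

theorem exists_forall_one_le_mul_norm_deriv_outgoingTheta (h : IsSolutionFamily q v Y)
    (hq : Continuous q) (hqs : IsSelfAdjoint q) (hv : IsSelfAdjoint v) (hv₀ : v ≠ 0) (hE : 0 < E) :
    ∃ C, ∀ M ≥ 1, 1 ≤ C * (‖Y E M‖ *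
      (‖deriv (outgoingTheta (fun z x => (Y z x).1) M) E‖ + ‖Y E M‖)) := by
  obtain ⟨J, hJ, hJle⟩ := h.exists_pos_forall_le_norm_wronskian_deriv hq hqs hv hv₀ E
  set d := ‖deriv Complex.sqrt E‖
  refine ⟨2 * (1 + 1 / √E) * (1 + d) / J, fun M hM => ?_⟩
  have hM₀ : 0 ≤ M := zero_le_one.trans hM
  have hsqrt := Real.sqrt_pos.2 hE
  set Θ' := deriv (outgoingTheta (fun z x => (Y z x).1) M) E with hΘ'
  have hform : ‖outgoingForm (√E : ℝ) (deriv (fun z => Y z M) E)‖ ≤ ‖Θ'‖ + d * ‖Y E M‖ := by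
    have heq := h.deriv_outgoingTheta hq hM₀ (Complex.ofReal_mem_slitPlane.2 hE)
    rw [sqrt_ofReal_of_nonneg hE.le, ← hΘ', eq_comm, sub_eq_iff_eq_add] at heq
    rw [heq]
    refine (norm_add_le _ _).trans (add_le_add_right ?_ _)
    rw [norm_mul, norm_mul, Complex.norm_I, one_mul]
    gcongr
    exact norm_fst_le _
  rw [div_mul_eq_mul_div, le_div_iff₀ hJ, one_mul]
  calc J ≤ 2 * (‖Y E M‖ * ‖deriv (fun z => Y z M) (E : ℂ)‖) :=
        (hJle M hM).trans (norm_wronskian_le _ _)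
    _ ≤ 2 * (‖Y E M‖ * ((1 + 1 / √E) * (‖Θ'‖ + d * ‖Y E M‖))) := by
        gcongr
        exact (norm_le_mul_norm_outgoingForm (h.isSelfAdjoint_deriv hq hqs hv E hM₀) hsqrt).trans
          (by gcongr)
    _ ≤ 2 * (‖Y E M‖ * ((1 + 1 / √E) * ((1 + d) * (‖Θ'‖ + ‖Y E M‖)))) := by
        have hd : 0 ≤ d := norm_nonneg _
        gcongr
        nlinarith [norm_nonneg Θ', norm_nonneg (Y E M)]
    _ = 2 * (1 + 1 / √E) * (1 + d) * (‖Y E M‖ * (‖Θ'‖ + ‖Y E M‖)) := by ring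

theorem exp_isBigO_deriv_outgoingTheta (h : IsSolutionFamily q v Y) (hq : Continuous q)
    (hqs : IsSelfAdjoint q) (hv : IsSelfAdjoint v) (hv₀ : v ≠ 0) (hE : 0 < E) (hκ : 0 < κ)
    (hY : Y E =O[atTop] fun x => Real.exp (-κ * x)) :
    (fun M => Real.exp (κ * M)) =O[atTop]
      fun M => deriv (outgoingTheta (fun z x => (Y z x).1) M) E := by
  obtain ⟨C, hC⟩ := h.exists_forall_one_le_mul_norm_deriv_outgoingTheta hq hqs hv hv₀ hE
  set Θ' := fun M => deriv (outgoingTheta (fun z x => (Y z x).1) M) E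
  have hlim : Tendsto (fun M => C * (‖Y E M‖ * ‖Y E M‖)) atTop (𝓝 0) := by
    have hexp : Tendsto (fun x => Real.exp (-κ * x)) atTop (𝓝 0) :=
      Real.tendsto_exp_atBot.comp (tendsto_id.const_mul_atTop_of_neg (neg_lt_zero.2 hκ))
    have hY₀ := (hY.trans_tendsto hexp).norm
    simpa using (hY₀.mul hY₀).const_mul C
  have hone : (fun _ => (1 : ℝ)) =O[atTop] fun M => ‖Y E M‖ * ‖Θ' M‖ := by
    refine .of_bound (2 * C) ?_
    filter_upwards [eventually_ge_atTop 1, hlim.eventually_le_const one_half_pos] with M hM hhalf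
    have hM := hC M hM
    rw [mul_add, mul_add] at hM
    rw [norm_one, Real.norm_of_nonneg (by positivity)]
    linarith
  have hmul := (Asymptotics.isBigO_refl (fun M => Real.exp (κ * M)) atTop).mul
    (hone.trans (hY.norm_left.mul (Asymptotics.isBigO_refl (fun M => ‖Θ' M‖) atTop)))
  refine (hmul.congr (fun M => mul_one _) fun M => ?_).of_norm_right
  rw [← mul_assoc, ← Real.exp_add]
  simp

theorem outgoingTheta_isBigO_exp (h : IsSolutionFamily q v Y)
    (hY : Y E =O[atTop] fun x => Real.exp (-κ * x)) :
    (fun M => outgoingTheta (fun z x => (Y z x).1) M E) =O[atTop]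
      fun M => Real.exp (-κ * M) := by
  refine .trans (.of_bound (1 + ‖Complex.sqrt E‖) (.of_forall fun M => ?_)) hY
  rw [h.outgoingTheta_eq]
  exact norm_outgoingForm_le _ _

theorem norm_sub_le_mul_exp (h : IsSolutionFamily q v Y) (hq : Continuous q) {z₀ z : ℂ}
    {r : ℝ → ℂ × ℂ} (hr : IsSolution (fun x => q x - z₀) r) (hW : wronskian v (r 0) = 1)
    (hκ : 0 < κ) {K R M : ℝ} (hM : 0 ≤ M) (hYK : ∀ x ≥ 0, ‖Y z₀ x‖ ≤ K * Real.exp (-κ * x))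
    (hrK : ∀ x ≥ 0, ‖r x‖ ≤ K * Real.exp (κ * x)) (hz : ‖z - z₀‖ * M ≤ R) :
    ‖Y z M - Y z₀ M‖ ≤ K ^ 3 / κ * Real.exp (2 * K ^ 2 * R) * Real.exp (κ * M) * ‖z - z₀‖ := by
  have hYc := (h.isSolution z₀).continuous
  have hK : 0 ≤ K := by simpa using (norm_nonneg _).trans (hYK 0 le_rfl)
  have hint : ∫ t in (0 : ℝ)..M, ‖(Y z₀ t).1‖ * Real.exp (-(κ * t)) ≤ K / (2 * κ) := by
    calc _ ≤ ∫ t in (0 : ℝ)..M, K * Real.exp (-(2 * κ) * t) := by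
          refine intervalIntegral.integral_mono_on hM
            ((by fun_prop : Continuous _).intervalIntegrable _ _)
            ((by fun_prop : Continuous _).intervalIntegrable _ _) fun t ht => ?_
          have hexp : Real.exp (-(2 * κ) * t) = Real.exp (-κ * t) * Real.exp (-(κ * t)) := by
            rw [← Real.exp_add]
            ring_nf
          rw [hexp, ← mul_assoc]
          gcongr
          exact (norm_fst_le _).trans (hYK t ht.1)
      _ = K / (2 * κ) * (1 - Real.exp (-(2 * κ) * M)) := by
          rw [intervalIntegral.integral_const_mul, intervalIntegral.integral_comp_mul_left
            Real.exp (neg_ne_zero.2 (by positivity)), integral_exp, mul_zero, Real.exp_zero,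
            smul_eq_mul]
          field_simp
          ring
      _ ≤ K / (2 * κ) := mul_le_of_le_one_right (by positivity) (by simp [Real.exp_nonneg])
  refine (h.norm_sub_le hq (h.isSolution z₀) hr (by rwa [h.apply_zero]) hκ.le hM
    (fun x hx => by simpa using hYK x hx.1) (fun x hx => hrK x hx.1) z).trans ?_
  calc _ ≤ 2 * K ^ 2 * ‖z - z₀‖ * Real.exp (κ * M) *
        (K / (2 * κ) * Real.exp (2 * K ^ 2 * R)) := by
        rw [mul_assoc (2 * K ^ 2) _ M]
        gcongr
    _ = _ := by
        field_simp

theorem exists_forall_norm_outgoingTheta_sub_le (h : IsSolutionFamily q v Y) (hq : Continuous q)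
    {r : ℝ → ℂ × ℂ} (hr : IsSolution (fun x => q x - E) r) (hW : wronskian v (r 0) = 1)
    (hE : 0 < E) (hκ : 0 < κ) {K : ℝ} (hYK : ∀ x ≥ 0, ‖Y E x‖ ≤ K * Real.exp (-κ * x))
    (hrK : ∀ x ≥ 0, ‖r x‖ ≤ K * Real.exp (κ * x)) :
    ∃ C, 0 ≤ C ∧ ∀ M ≥ 1, ∀ z ∈ Metric.ball (E : ℂ) (E / M),
      ‖outgoingTheta (fun z x => (Y z x).1) M z - outgoingTheta (fun z x => (Y z x).1) M E‖ ≤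
        C * Real.exp (κ * M) * ‖z - E‖ := by
  have hK : 0 ≤ K := by simpa using (norm_nonneg _).trans (hYK 0 le_rfl)
  refine ⟨(1 + 2 * √E) * (K ^ 3 / κ * Real.exp (2 * K ^ 2 * E)) + K / √E, by positivity,
    fun M hM z hz => ?_⟩
  have hM₀ : 0 < M := zero_lt_one.trans_le hM
  have hzM : ‖z - E‖ * M ≤ E := ((lt_div_iff₀ hM₀).1 (mem_ball_iff_norm.1 hz)).le
  have hzE : ‖z - E‖ ≤ E := (le_mul_of_one_le_right (norm_nonneg _) hM).trans hzM
  have hYE : ‖Y E M‖ ≤ K * Real.exp (κ * M) :=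
    (hYK M hM₀.le).trans (by gcongr; linarith)
  rw [h.outgoingTheta_eq]
  calc _ ≤ (1 + 2 * √E) * ‖Y z M - Y E M‖ + ‖z - E‖ / √E * ‖Y E M‖ :=
        norm_outgoingForm_sqrt_sub_le hE hzE _ _
    _ ≤ (1 + 2 * √E) * (K ^ 3 / κ * Real.exp (2 * K ^ 2 * E) * Real.exp (κ * M) * ‖z - E‖) +
        ‖z - E‖ / √E * (K * Real.exp (κ * M)) := by
        gcongr
        exact h.norm_sub_le_mul_exp hq hr hW hκ hM₀.le hYK hrK hzM
    _ = _ := by ring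

end IsSolutionFamily

end ResonanceBounds

section Resonance

theorem hasUniqueRootNear_of_norm_sub_le {f : ℂ → ℂ} {E A B D R r : ℝ}
    (hf : DifferentiableOn ℂ f (Metric.ball E R))
    (hfB : ∀ z ∈ Metric.ball (E : ℂ) R, ‖f z - f E‖ ≤ B * ‖z - E‖) (hB : 0 ≤ B)
    (hD : 0 < D) (hfD : D ≤ ‖deriv f E‖) (hfA : ‖f E‖ ≤ A) (hr : 0 ≤ r) (hrR : r < R / 2)
    (hBr : 16 * B * r ≤ D * R) (hAr : 2 * A ≤ D * r) :
    HasUniqueRootNear f E r (32 * B * A ^ 2 / (R * D ^ 3)) := by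
  have hR : 0 < R := by linarith
  have hK : ∀ z ∈ Metric.ball (E : ℂ) R, ‖f z - f E‖ ≤ B * R := fun z hz =>
    (hfB z hz).trans (by gcongr; exact (mem_ball_iff_norm.1 hz).le)
  have hsub : Metric.closedBall (E : ℂ) r ⊆ Metric.ball (E : ℂ) (R / 2) :=
    Metric.closedBall_subset_ball hrR
  have hderiv : ∀ z ∈ Metric.closedBall (E : ℂ) r,
      ‖deriv f z - deriv f E‖ ≤ 8 * B / R * ‖z - E‖ := fun z hz => by
    have := norm_deriv_sub_deriv_le_of_norm_le (hf.sub_const (f E)) hK (hsub hz)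
    rw [deriv_sub_const, deriv_sub_const] at this
    exact this.trans_eq (by field_simp)
  have hD' : deriv f E ≠ 0 := norm_pos_iff.1 (hD.trans_le hfD)
  obtain ⟨zs, hzs, hroot, huniq, herr⟩ := exists_unique_root_of_norm_deriv_sub_le (L := 8 * B / R)
    (by positivity) (fun z hz => hf.differentiableAt (Metric.isOpen_ball.mem_nhds
      (Metric.ball_subset_ball (by linarith) (hsub hz)))) hderiv hD'
    (by
      refine le_trans ?_ hfD
      rw [div_mul_eq_mul_div, mul_div_assoc', div_le_iff₀ hR]
      linarith)
    (by linarith [mul_le_mul_of_nonneg_right hfD hr])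
  refine ⟨hD', zs, hzs, hroot, huniq, herr.trans ?_⟩
  calc 4 * (8 * B / R) * ‖f E‖ ^ 2 / ‖deriv f E‖ ^ 3 ≤ 4 * (8 * B / R) * A ^ 2 / D ^ 3 := by
        gcongr
    _ = 32 * B * A ^ 2 / (R * D ^ 3) := by
        field_simp
        ring

theorem tendsto_sq_mul_exp_neg_mul_atTop {κ : ℝ} (hκ : 0 < κ) :
    Tendsto (fun M => M ^ 2 * Real.exp (-κ * M)) atTop (𝓝 0) := by
  simpa using tendsto_rpow_mul_exp_neg_mul_atTop_nhds_zero 2 κ hκ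

theorem hasUniqueRootNear_of_scaled_bounds {f : ℂ → ℂ} {A B D E F M R r : ℝ}
    (hB : 0 ≤ B) (hD : 0 < D) (hF : 0 < F) (hM : 0 < M) (hR : 0 < R)
    (hf : DifferentiableOn ℂ f (Metric.ball E (R / M)))
    (hfB : ∀ z ∈ Metric.ball (E : ℂ) (R / M), ‖f z - f E‖ ≤ B * F * ‖z - E‖)
    (hfA : ‖f E‖ ≤ A * F⁻¹) (hfD : F ≤ D * ‖deriv f E‖) (hr : F⁻¹ / M ^ 2 ≤ r)
    (hr' : r ≤ 1 / M ^ 2) (hRM : 2 < M * R) (hBM : 16 * B * D ≤ M * R)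
    (hAM : 2 * A * D * (M ^ 2 * F⁻¹) ≤ 1) :
    HasUniqueRootNear f E r (32 * B * A ^ 2 * D ^ 3 / R * M * F⁻¹ ^ 4) := by
  have hrR : 1 / M ^ 2 < R / M / 2 := by
    rw [div_div, div_lt_div_iff₀ (by positivity) (by positivity)]
    nlinarith
  have hBr : 16 * (B * F) * r ≤ F / D * (R / M) := by
    calc 16 * (B * F) * r ≤ 16 * (B * F) * (1 / M ^ 2) := by gcongr
      _ = 16 * B * D * (F / (D * M ^ 2)) := by field_simp
      _ ≤ M * R * (F / (D * M ^ 2)) := by gcongr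
      _ = F / D * (R / M) := by field_simp
  have hAr : 2 * (A * F⁻¹) ≤ F / D * r := by
    calc 2 * (A * F⁻¹) = 2 * A * D * (M ^ 2 * F⁻¹) * (1 / (D * M ^ 2)) := by field_simp
      _ ≤ 1 * (1 / (D * M ^ 2)) := by gcongr
      _ = F / D * (F⁻¹ / M ^ 2) := by field_simp
      _ ≤ F / D * r := by gcongr
  have hroot := hasUniqueRootNear_of_norm_sub_le hf hfB (by positivity) (by positivity)
    ((div_le_iff₀' hD).2 hfD) hfA (hr.trans' (by positivity)) (hr'.trans_lt hrR) hBr hAr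
  convert hroot using 1
  field_simp

theorem exists_eventually_forall_hasUniqueRootNear_of_isBigO {Θ : ℝ → ℂ → ℂ} {E R B κ : ℝ}
    (hR : 0 < R) (hκ : 0 < κ) (hB : 0 ≤ B)
    (hΘd : ∀ M ≥ 1, DifferentiableOn ℂ (Θ M) (Metric.ball E (R / M)))
    (hΘB : ∀ M ≥ 1, ∀ z ∈ Metric.ball (E : ℂ) (R / M),
      ‖Θ M z - Θ M E‖ ≤ B * Real.exp (κ * M) * ‖z - E‖)
    (hΘ : (fun M => Θ M E) =O[atTop] fun M => Real.exp (-κ * M))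
    (hΘ' : (fun M => Real.exp (κ * M)) =O[atTop] fun M => deriv (Θ M) E) :
    ∃ C, 0 ≤ C ∧ ∀ᶠ M in atTop, ∀ k, 0 < k → k ≤ κ →
      HasUniqueRootNear (Θ M) E (1 / M ^ 2 * Real.exp (-k * M))
        (C * M * Real.exp (-4 * κ * M)) := by
  obtain ⟨A, hA, hΘ⟩ := hΘ.exists_pos
  obtain ⟨D, hD, hΘ'⟩ := hΘ'.exists_pos
  have hlim := ((tendsto_sq_mul_exp_neg_mul_atTop hκ).const_mul (2 * A * D)).eventually_le_const
    (u := 1) (by simp)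
  refine ⟨32 * B * A ^ 2 * D ^ 3 / R, by positivity, ?_⟩
  filter_upwards [hΘ.bound, hΘ'.bound, hlim, eventually_ge_atTop 1, eventually_gt_atTop (2 / R),
    eventually_ge_atTop (16 * B * D / R)] with M hA' hD' hAM hM hRM hBM k hk hkκ
  have hM₀ : 0 < M := zero_lt_one.trans_le hM
  have hinv : Real.exp (-κ * M) = (Real.exp (κ * M))⁻¹ := by rw [neg_mul, Real.exp_neg]
  have hpow : Real.exp (-4 * κ * M) = (Real.exp (κ * M))⁻¹ ^ 4 := by
    rw [← hinv, ← Real.exp_nat_mul]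
    ring_nf
  rw [Real.norm_of_nonneg (Real.exp_pos _).le] at hA' hD'
  rw [hpow]
  refine hasUniqueRootNear_of_scaled_bounds hB hD (Real.exp_pos _) hM₀ hR (hΘd M hM)
    (hΘB M hM) (hinv ▸ hA') hD' ?_ ?_ ((div_lt_iff₀ hR).1 hRM) ((div_le_iff₀ hR).1 hBM)
    (hinv ▸ hAM)
  · rw [← hinv, div_eq_inv_mul, one_div]
    gcongr
  · exact mul_le_of_le_one_right (by positivity) (Real.exp_le_one_iff.2 (by nlinarith))

end Resonance

section EventuallyPeriodic

theorem exists_forall_norm_le_mul_exp {F : Type*} [NormedAddCommGroup F] {f : ℝ → F} {κ : ℝ}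
    (hf : Continuous f) (hfκ : f =O[atTop] fun x => Real.exp (κ * x)) :
    ∃ K, ∀ x ≥ 0, ‖f x‖ ≤ K * Real.exp (κ * x) := by
  obtain ⟨C, hC⟩ := hfκ.bound
  obtain ⟨N, hN⟩ := eventually_atTop.1 hC
  have hcont : Continuous fun x => ‖f x‖ / Real.exp (κ * x) := by fun_prop (disch := simp)
  obtain ⟨B, hB⟩ := (isCompact_Icc (a := 0) (b := N)).bddAbove_image hcont.continuousOn
  refine ⟨max B C, fun x hx => ?_⟩
  rw [← div_le_iff₀ (Real.exp_pos _)]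
  rcases le_total x N with hxN | hxN
  · exact (hB ⟨x, ⟨hx, hxN⟩, rfl⟩).trans (le_max_left _ _)
  · rw [div_le_iff₀ (Real.exp_pos _)]
    refine (hN x hxN).trans ?_
    rw [Real.norm_of_nonneg (Real.exp_pos _).le]
    gcongr
    exact le_max_right _ _

variable {q Q : ℝ → ℂ} {N : ℝ} {y : ℝ → ℂ × ℂ}

theorem isBoundedUnder_norm_of_eqOn_Ici (hQ : Continuous Q) (hQp : Q.Periodic 1)
    (hqQ : Set.EqOn q Q (Set.Ici N)) : IsBoundedUnder (· ≤ ·) atTop fun x => ‖q x‖ := by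
  obtain ⟨C, hC⟩ := (hQp.isBounded_of_continuous one_ne_zero hQ).exists_norm_le
  refine isBoundedUnder_of_eventually_le (a := C) ?_
  filter_upwards [eventually_ge_atTop N] with x hx
  rw [hqQ hx]
  exact hC _ ⟨x, rfl⟩

theorem IsSolution.exists_eqOn_Ici (hy : IsSolution q y) (hq : Continuous q) (hQ : Continuous Q)
    (hqQ : Set.EqOn q Q (Set.Ici N)) :
    ∃ w, IsSolution Q w ∧ Set.EqOn y w (Set.Ici N) := by
  obtain ⟨w, hw, hw₀⟩ := IsSolution.exists_apply_eq hQ N (y N)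
  refine ⟨w, hw, fun x hx => hy.apply_eq_of_eqOn_uIcc hw hq hQ (hqQ.mono ?_) hw₀.symm⟩
  rw [Set.uIcc_of_le hx]
  exact Set.Icc_subset_Ici_self

theorem IsSolution.exists_isFloquetSolution_isBigO (hy : IsSolution q y) (hq : Continuous q)
    (hQ : Continuous Q) (hQp : Q.Periodic 1) (hQs : IsSelfAdjoint Q)
    (hqQ : Set.EqOn q Q (Set.Ici N)) (hys : IsSelfAdjoint y) (hne : y ≠ 0)
    (hlim : Tendsto y atTop (𝓝 0)) :
    ∃ (c : ℝ) (w : ℝ → ℂ × ℂ), |c| < 1 ∧ IsFloquetSolution Q c w ∧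
      y =O[atTop] fun x => Real.exp (Real.log |c| * x) := by
  obtain ⟨w, hw, hyw⟩ := hy.exists_eqOn_Ici hq hQ hqQ
  have hev : y =ᶠ[atTop] w := hyw.eventuallyEq_of_mem (Ici_mem_atTop N)
  have hyN : y N = w N := hyw Set.self_mem_Ici
  have hws : IsSelfAdjoint (w N) := hyN ▸ congrFun hys N
  have hwne : w ≠ 0 := fun h₀ => hy.ne_zero hq hne N (by rw [hyN, h₀, Pi.zero_apply])
  obtain ⟨c, hc, hwc⟩ := hw.exists_isFloquetSolution hQ hQp (hw.isSelfAdjoint hQ hQs hws) hwne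
    (hlim.congr' hev)
  refine ⟨c, w, hc, hwc, hev.trans_isBigO ?_⟩
  simpa using isBigO_exp_of_apply_add_one hw.continuous (hwc.multiplier_ne_zero hQ)
    hwc.apply_add_one

theorem IsFloquetSolution.isBigO_exp_of_eqOn_Ici {c : ℂ} {w : ℝ → ℂ × ℂ}
    (hw : IsFloquetSolution Q c w) (hQ : Continuous Q) (hQe : Q.Even) (hc : ‖c‖ < 1)
    (hqQ : Set.EqOn q Q (Set.Ici N)) (hq : Continuous q) (hy : IsSolution q y) :
    y =O[atTop] fun x => Real.exp (-Real.log ‖c‖ * x) := by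
  obtain ⟨w', hw', hyw'⟩ := hy.exists_eqOn_Ici hq hQ hqQ
  exact (hyw'.eventuallyEq_of_mem (Ici_mem_atTop N)).trans_isBigO (hw.isBigO_exp hQ hQe hc hw')

end EventuallyPeriodic

theorem IsSolutionFamily.exists_eventually_forall_hasUniqueRootNear {q : ℝ → ℂ} {v : ℂ × ℂ}
    {Y : ℂ → ℝ → ℂ × ℂ} {E κ : ℝ} (h : IsSolutionFamily q v Y) (hq : Continuous q)
    (hqs : IsSelfAdjoint q) (hv : IsSelfAdjoint v) (hv₀ : v ≠ 0) (hE : 0 < E) (hκ : 0 < κ)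
    (hY : Y E =O[atTop] fun x => Real.exp (-κ * x))
    (hgrowth : ∀ r, IsSolution (fun x => q x - E) r → r =O[atTop] fun x => Real.exp (κ * x)) :
    ∃ C, 0 ≤ C ∧ ∀ᶠ M in atTop, ∀ k, 0 < k → k ≤ κ →
      HasUniqueRootNear (outgoingTheta (fun z x => (Y z x).1) M) E
        (1 / M ^ 2 * Real.exp (-k * M)) (C * M * Real.exp (-4 * κ * M)) := by
  obtain ⟨w, hw⟩ := exists_wronskian_eq_one hv₀
  obtain ⟨r, hr, hr₀⟩ :=
    IsSolution.exists_apply_eq (by fun_prop : Continuous fun x => q x - (E : ℂ)) 0 w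
  obtain ⟨K₁, hK₁⟩ := exists_forall_norm_le_mul_exp (h.isSolution E).continuous hY
  obtain ⟨K₂, hK₂⟩ := exists_forall_norm_le_mul_exp hr.continuous (hgrowth r hr)
  obtain ⟨B, hB, hlip⟩ := h.exists_forall_norm_outgoingTheta_sub_le (K := max K₁ K₂) hq hr
    (by rw [hr₀, hw]) hE hκ
    (fun x hx => (hK₁ x hx).trans (by gcongr; exact le_max_left K₁ K₂))
    (fun x hx => (hK₂ x hx).trans (by gcongr; exact le_max_right K₁ K₂))
  refine exists_eventually_forall_hasUniqueRootNear_of_isBigO hE hκ hB (fun M hM z hz => ?_) hlip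
    (h.outgoingTheta_isBigO_exp hY) (h.exp_isBigO_deriv_outgoingTheta hq hqs hv hv₀ hE hκ hY)
  exact (h.differentiableAt_outgoingTheta hq (zero_le_one.trans hM) (mem_slitPlane_of_mem_ball
    (Metric.ball_subset_ball (div_le_self hE.le hM) hz))).differentiableWithinAt

section Potential

variable {V W : ℝ → ℝ} {z : ℂ}

theorem SolvesSchrodinger.isSolution {u : ℝ → ℂ} (h : SolvesSchrodinger V z u) :
    IsSolution (fun x => V x - z) fun x => (u x, deriv u x) := fun x => by
  have hderiv : ContDiff ℝ 1 (deriv u) := .deriv' (by simpa [one_add_one_eq_two] using h.1)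
  refine ((h.1.differentiable two_ne_zero x).hasDerivAt.prodMk
    (hderiv.differentiable one_ne_zero x).hasDerivAt).congr_deriv (Prod.ext rfl ?_)
  linear_combination -h.2 x

theorem IsSolution.solvesSchrodinger {y : ℝ → ℂ × ℂ} (hy : IsSolution (fun x => V x - z) y)
    (hV : Continuous V) : SolvesSchrodinger V z fun x => (y x).1 := by
  have hderiv : deriv (fun x => (y x).1) = fun x => (y x).2 :=
    funext fun x => (hy.hasDerivAt_fst x).deriv
  have hderiv₂ : deriv (fun x => (y x).2) = fun x => (V x - z) * (y x).1 :=
    funext fun x => (hy.hasDerivAt_snd x).deriv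
  have hyc := hy.continuous
  refine ⟨?_, fun x => ?_⟩
  · rw [← one_add_one_eq_two, contDiff_succ_iff_deriv, hderiv, contDiff_one_iff_deriv, hderiv₂]
    exact ⟨fun x => (hy.hasDerivAt_fst x).differentiableAt, by simp,
      fun x => (hy.hasDerivAt_snd x).differentiableAt, by fun_prop⟩
  · rw [hderiv, hderiv₂]
    ring

theorem IsFloquetSolution.isFloquetMultiplier {y : ℝ → ℂ × ℂ} {E μ : ℝ}
    (hy : IsFloquetSolution (fun x => W x - E) μ y) (hW : Continuous W) :
    IsFloquetMultiplier W E μ := by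
  refine ⟨_, hy.isSolution.solvesSchrodinger hW, fun h₀ => ?_,
    fun x => congrArg Prod.fst (hy.apply_add_one x)⟩
  obtain ⟨x, -, hx⟩ := hy.isSolution.exists_fst_ne_zero (by fun_prop) hy.ne_zero zero_lt_one
  exact hx (congrFun h₀ x)

theorem IsFloquetSolution.isFloquetMultiplier_inv {y : ℝ → ℂ × ℂ} {E μ : ℝ}
    (hy : IsFloquetSolution (fun x => W x - E) μ y) (hW : Continuous W) (hWe : W.Even) :
    IsFloquetMultiplier W E μ⁻¹ := by
  have h := hy.reflect (by fun_prop) fun x => by simp only [hWe x]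
  rw [← Complex.ofReal_inv] at h
  exact h.isFloquetMultiplier hW

variable {ρ : ℝ}

theorem eq_apply_add_natCast_of_periodic (hW : W.Periodic 1) (hVW : ∀ x, ρ < |x| → V x = W x)
    {x : ℝ} {n : ℕ} (hn : ρ < x + n) : W x = V (x + n) := by
  rw [hVW _ (hn.trans_le (le_abs_self _))]
  simpa using (hW.nat_mul n x).symm

theorem continuous_of_periodic (hW : W.Periodic 1) (hVW : ∀ x, ρ < |x| → V x = W x)
    (hV : Continuous V) : Continuous W := continuous_iff_continuousAt.2 fun x => by
  obtain ⟨n, hn⟩ := exists_nat_gt (ρ - x + 1)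
  refine ContinuousAt.congr (f := fun y => V (y + n)) (by fun_prop) ?_
  filter_upwards [lt_mem_nhds (sub_one_lt x)] with y hy
  exact (eq_apply_add_natCast_of_periodic hW hVW (by linarith)).symm

theorem even_of_periodic (hW : W.Periodic 1) (hVW : ∀ x, ρ < |x| → V x = W x) (hV : V.Even) :
    W.Even := fun x => by
  obtain ⟨n, hn⟩ := exists_nat_gt (ρ - x)
  have hn' : ρ < x + n := by linarith
  calc W (-x) = W (-(x + n)) := by simpa only [neg_add', mul_one] using (hW.sub_nat_mul_eq n).symm
    _ = V (-(x + n)) := (hVW _ (by rw [abs_neg]; exact hn'.trans_le (le_abs_self _))).symm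
    _ = W x := by rw [hV, eq_apply_add_natCast_of_periodic hW hVW hn']

theorem isSelfAdjoint_ofReal (V : ℝ → ℝ) : IsSelfAdjoint fun x => (V x : ℂ) :=
  funext fun _ => Complex.conj_ofReal _

theorem IsBoundState.exists_isSolutionFamily {E : ℝ} {Φ : ℝ → ℂ} (hΦ : IsBoundState V E Φ)
    (hV : Continuous V) (hVe : V.Even)
    (hbdd : IsBoundedUnder (· ≤ ·) atTop fun x => ‖(V x - E : ℂ)‖) :
    ∃ (a b : ℂ) (Y : ℂ → ℝ → ℂ × ℂ),
      ((Function.Even Φ ∧ a = 1 ∧ b = 0) ∨ (Function.Odd Φ ∧ a = 0 ∧ b = 1)) ∧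
      IsSolutionFamily (fun x => V x) (a, b) Y ∧ Tendsto (Y E) atTop (𝓝 0) := by
  obtain ⟨hsol, hL, hne⟩ := hΦ
  have hy := hsol.isSolution
  have hq : Continuous fun x => (V x - E : ℂ) := by fun_prop
  have hyne : (fun x => (Φ x, deriv Φ x)) ≠ 0 := fun h₀ =>
    hne (funext fun x => congrArg Prod.fst (congrFun h₀ x))
  obtain ⟨a, b, c, hparity, hab⟩ :=
    hy.exists_parity_of_memLp_two hq (fun x => by simp only [hVe x]) hbdd hL hyne
  obtain ⟨Y, hY⟩ := IsSolutionFamily.exists_of_continuous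
    (by fun_prop : Continuous fun x => (V x : ℂ)) (a, b)
  have hYE := (hY.isSolution E).eq_of_apply_eq (hy.const_smul c) hq ((hY.apply_zero E).trans hab)
  refine ⟨a, b, Y, hparity, hY, ?_⟩
  rw [hYE]
  simpa using (hy.tendsto_zero_of_memLp_two hq hbdd hL).const_smul c

theorem IsSolutionFamily.solvesSchrodinger {a b : ℂ} {Y : ℂ → ℝ → ℂ × ℂ}
    (h : IsSolutionFamily (fun x => V x) (a, b) Y) (hV : Continuous V) (z : ℂ) :
    SolvesSchrodinger V z (fun x => (Y z x).1) ∧ (Y z 0).1 = a ∧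
      deriv (fun x => (Y z x).1) 0 = b :=
  ⟨(h.isSolution z).solvesSchrodinger hV, congrArg Prod.fst (h.apply_zero z),
    ((h.isSolution z).hasDerivAt_fst 0).deriv.trans (congrArg Prod.snd (h.apply_zero z))⟩

theorem IsSolutionFamily.exists_isFloquetSolution_hasUniqueRootNear {v : ℂ × ℂ}
    {Y : ℂ → ℝ → ℂ × ℂ} {E N : ℝ}
    (h : IsSolutionFamily (fun x => V x) v Y) (hV : Continuous V) (hW : Continuous W)
    (hWp : W.Periodic 1) (hWe : W.Even) (hVW : Set.EqOn V W (Set.Ici N)) (hv : IsSelfAdjoint v)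
    (hv₀ : v ≠ 0) (hE : 0 < E) (hlim : Tendsto (Y E) atTop (𝓝 0)) :
    ∃ (c : ℝ) (w : ℝ → ℂ × ℂ), |c| < 1 ∧ IsFloquetSolution (fun x => W x - E) c w ∧
      ∃ C, 0 ≤ C ∧ ∀ᶠ M in atTop, ∀ k, 0 < k → k ≤ -Real.log |c| →
        HasUniqueRootNear (outgoingTheta (fun z x => (Y z x).1) M) E
          (1 / M ^ 2 * Real.exp (-k * M)) (C * M * Real.exp (-4 * -Real.log |c| * M)) := by
  have hVc : Continuous fun x => (V x : ℂ) := by fun_prop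
  have hQ : Continuous fun x => (W x - E : ℂ) := by fun_prop
  have hqQ : Set.EqOn (fun x => (V x - E : ℂ)) (fun x => W x - E) (Set.Ici N) := fun x hx => by
    simp only [hVW hx]
  have hne : Y E ≠ 0 := fun h₀ => hv₀ (by rw [← h.apply_zero E, h₀, Pi.zero_apply])
  obtain ⟨c, w, hc, hw, hdecay⟩ := (h.isSolution E).exists_isFloquetSolution_isBigO (by fun_prop)
    hQ (fun x => by simp only [hWp x]) (by simpa using isSelfAdjoint_ofReal fun x => W x - E) hqQ
    (funext (h.isSelfAdjoint_apply hVc (isSelfAdjoint_ofReal V) hv E)) hne hlim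
  have hc₀ : 0 < |c| := abs_pos.2 (Complex.ofReal_ne_zero.1 (hw.multiplier_ne_zero hQ))
  have hc' : ‖(c : ℂ)‖ < 1 := by simpa using hc
  refine ⟨c, w, hc, hw, h.exists_eventually_forall_hasUniqueRootNear hVc (isSelfAdjoint_ofReal V)
    hv hv₀ hE (neg_pos.2 (Real.log_neg hc₀ hc)) (by simpa using hdecay) fun r hr => ?_⟩
  simpa using hw.isBigO_exp_of_eqOn_Ici hQ (fun x => by simp only [hWe x]) hc' hqQ
    (by fun_prop) hr

end Potential

section Rates

theorem HasUniqueRootNear.mono {Θ : ℂ → ℂ} {E r err err' : ℝ} (h : HasUniqueRootNear Θ E r err)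
    (herr : err ≤ err') : HasUniqueRootNear Θ E r err' := by
  obtain ⟨hD, zs, hzs, hroot, huniq, hle⟩ := h
  exact ⟨hD, zs, hzs, hroot, huniq, hle.trans herr⟩

theorem mul_exp_neg_mul_le {κ k : ℝ} (hk : k < κ) (M : ℝ) :
    M * Real.exp (-4 * κ * M) ≤ 1 / (4 * (κ - k)) * Real.exp (-4 * k * M) := by
  have hδ : 0 < 4 * (κ - k) := by linarith
  have hle : 4 * (κ - k) * M ≤ Real.exp (4 * (κ - k) * M) :=
    (lt_add_one _).le.trans (Real.add_one_le_exp _)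
  have hsplit : Real.exp (-4 * k * M) = Real.exp (4 * (κ - k) * M) * Real.exp (-4 * κ * M) := by
    rw [← Real.exp_add]
    ring_nf
  rw [hsplit, ← mul_assoc]
  gcongr
  rw [one_div_mul_eq_div, le_div_iff₀' hδ]
  exact hle

theorem exists_forall_hasUniqueRootNear_of_eventually {Θ : ℝ → ℂ → ℂ} {E κ : ℝ}
    (h : ∃ C, 0 ≤ C ∧ ∀ᶠ M in atTop, ∀ k, 0 < k → k ≤ κ →
      HasUniqueRootNear (Θ M) E (1 / M ^ 2 * Real.exp (-k * M)) (C * M * Real.exp (-4 * κ * M)))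
    (hκ : 0 < κ) (ρ : ℝ) :
    (∀ k : ℝ, 0 < k → k < κ → ∃ M₀ C : ℝ, ρ < M₀ ∧ ∀ M : ℝ, M₀ ≤ M →
      HasUniqueRootNear (Θ M) E (1 / M ^ 2 * Real.exp (-k * M)) (C * Real.exp (-4 * k * M))) ∧
    ∃ M₀ C : ℝ, ρ < M₀ ∧ ∀ M : ℝ, M₀ ≤ M →
      HasUniqueRootNear (Θ M) E (1 / M ^ 2 * Real.exp (-κ * M))
        (C * M * Real.exp (-4 * κ * M)) := by
  obtain ⟨C, hC, hev⟩ := h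
  obtain ⟨M₀, hM₀⟩ := eventually_atTop.1 (hev.and (eventually_gt_atTop ρ))
  refine ⟨fun k hk hkκ => ⟨M₀, C * (1 / (4 * (κ - k))), (hM₀ M₀ le_rfl).2, fun M hM =>
    ((hM₀ M hM).1 k hk hkκ.le).mono ?_⟩,
    M₀, C, (hM₀ M₀ le_rfl).2, fun M hM => (hM₀ M hM).1 κ hκ le_rfl⟩
  rw [mul_assoc C, mul_assoc C]
  exact mul_le_mul_of_nonneg_left (mul_exp_neg_mul_le hkκ M) hC

end Rates

theorem theorem1_general
    (V Vper Vdef : ℝ → ℝ) (ρ : ℝ) (hV : Continuous V)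
    (hdecomp : ∀ x : ℝ, V x = Vper x + Vdef x)
    (hper : ∀ x : ℝ, Vper (x + 1) = Vper x)
    (hdef : ∀ x : ℝ, ρ < |x| → Vdef x = 0)
    (heven : ∀ x : ℝ, V (-x) = V x)
    (E : ℝ) (hE : 0 < E) (Φ : ℝ → ℂ) (hΦ : IsBoundState V E Φ) :
    ∃ (a b : ℂ) (u : ℂ → ℝ → ℂ) (μ κ : ℝ),
      ((Function.Even Φ ∧ a = 1 ∧ b = 0) ∨ (Function.Odd Φ ∧ a = 0 ∧ b = 1)) ∧
      (∀ z : ℂ, SolvesSchrodinger V z (u z) ∧ u z 0 = a ∧ deriv (u z) 0 = b) ∧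
      1 < |μ| ∧ IsFloquetMultiplier Vper E μ ∧ IsFloquetMultiplier Vper E μ⁻¹ ∧
      κ = Real.log |μ| ∧
      (∀ k : ℝ, 0 < k → k < κ →
        ∃ M₀ C : ℝ, ρ < M₀ ∧ ∀ M : ℝ, M₀ ≤ M →
          HasUniqueRootNear (outgoingTheta u M) E
            (1 / M ^ 2 * Real.exp (-k * M)) (C * Real.exp (-4 * k * M))) ∧
      (∃ M₀ C : ℝ, ρ < M₀ ∧ ∀ M : ℝ, M₀ ≤ M →
          HasUniqueRootNear (outgoingTheta u M) E
            (1 / M ^ 2 * Real.exp (-κ * M)) (C * M * Real.exp (-4 * κ * M))) := by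
  have hVW (x : ℝ) (hx : ρ < |x|) : V x = Vper x := by rw [hdecomp, hdef x hx, add_zero]
  have hW := continuous_of_periodic hper hVW hV
  have hWe := even_of_periodic hper hVW heven
  have hVW' : Set.EqOn V Vper (Set.Ici (ρ + 1)) := fun x hx =>
    hVW x (by linarith [le_abs_self x, Set.mem_Ici.1 hx])
  have hbdd : IsBoundedUnder (· ≤ ·) atTop fun x => ‖(V x - E : ℂ)‖ :=
    isBoundedUnder_norm_of_eqOn_Ici (N := ρ + 1) (Q := fun x => Vper x - E) (by fun_prop)
      (fun x => by simp only [hper x]) fun x hx => by simp only [hVW' hx]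
  obtain ⟨a, b, Y, hparity, hY, hlim⟩ := hΦ.exists_isSolutionFamily hV heven hbdd
  have hab : IsSelfAdjoint (a, b) ∧ (a, b) ≠ 0 := by
    rcases hparity with ⟨-, rfl, rfl⟩ | ⟨-, rfl, rfl⟩ <;> simp [IsSelfAdjoint, Prod.ext_iff]
  obtain ⟨c, w, hc, hw, hroot⟩ :=
    hY.exists_isFloquetSolution_hasUniqueRootNear hV hW hper hWe hVW' hab.1 hab.2 hE hlim
  have hc₀ := hw.multiplier_ne_zero (by fun_prop)
  have hμ : 1 < |c⁻¹| := by
    rw [abs_inv]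
    exact (one_lt_inv₀ (abs_pos.2 (Complex.ofReal_ne_zero.1 hc₀))).2 hc
  refine ⟨a, b, fun z x => (Y z x).1, c⁻¹, Real.log |c⁻¹|, hparity, hY.solvesSchrodinger hV, hμ,
    hw.isFloquetMultiplier_inv hW hWe, by rw [inv_inv]; exact hw.isFloquetMultiplier hW, rfl,
    exists_forall_hasUniqueRootNear_of_eventually (by rwa [abs_inv, Real.log_inv])
      (Real.log_pos hμ) ρ⟩

theorem theorem1
    (V Vper Vdef : ℝ → ℝ) (ρ : ℝ) (hρ : 0 ≤ ρ)
    (hV : ContDiff ℝ ∞ V)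
    (hdecomp : ∀ x : ℝ, V x = Vper x + Vdef x)
    (hper : ∀ x : ℝ, Vper (x + 1) = Vper x)
    (hdef : ∀ x : ℝ, ρ < |x| → Vdef x = 0)
    (heven : ∀ x : ℝ, V (-x) = V x)
    (E : ℝ) (hE : 0 < E) (Φ : ℝ → ℂ) (hΦ : IsBoundState V E Φ) :
    ∃ (a b : ℂ) (u : ℂ → ℝ → ℂ) (μ κ : ℝ),
      -- the bound state is even or odd, which fixes the initial data `(a, b)`
      ((Function.Even Φ ∧ a = 1 ∧ b = 0) ∨ (Function.Odd Φ ∧ a = 0 ∧ b = 1)) ∧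
      -- `u z` is the solution of the initial value problem
      (∀ z : ℂ, SolvesSchrodinger V z (u z) ∧ u z 0 = a ∧ deriv (u z) 0 = b) ∧
      -- the Floquet multipliers `μ, μ⁻¹` at energy `E` are real, and `κ = log |μ| > 0`
      1 < |μ| ∧ IsFloquetMultiplier Vper E μ ∧ IsFloquetMultiplier Vper E μ⁻¹ ∧
      κ = Real.log |μ| ∧
      -- every rate `k < κ`, with error `O(e^{-4kM})`
      (∀ k : ℝ, 0 < k → k < κ →
        ∃ M₀ C : ℝ, ρ < M₀ ∧ ∀ M : ℝ, M₀ ≤ M →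
          HasUniqueRootNear (outgoingTheta u M) E
            (1 / M ^ 2 * Real.exp (-k * M)) (C * Real.exp (-4 * k * M))) ∧
      -- the rate `κ` itself, with error `O(M e^{-4κM})`
      (∃ M₀ C : ℝ, ρ < M₀ ∧ ∀ M : ℝ, M₀ ≤ M →
          HasUniqueRootNear (outgoingTheta u M) E
            (1 / M ^ 2 * Real.exp (-κ * M)) (C * M * Real.exp (-4 * κ * M))) :=
  theorem1_general V Vper Vdef ρ hV.continuous hdecomp hper hdef heven E hE Φ hΦ
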